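/- **Conventions.** All Banach spaces are real. For a Banach space $X$ with a normalized Schauder basis $(e_j)$ let $(e_j^*)\subset X^*$ be its coordinate functionals; its basis constant is $\sup_n\|P_n\|$, where $P_nx=\sum_{j\le n}e_j^*(x)e_j$. For a bounded linear $T\colon U\to U$, a Banach space $V$ and $c>0$, *the identity on $V$ $c$-factors through $T$* if there are bounded linear $B\colon V\to U$, $A\colon U\to V$ with $ATB=I_V$ and $\|A\|\|B\|\le c$; it *almost $c$-factors through $T$* if it $(c+\varepsilon)$-factors through $T$ for every $\varepsilon>0$. For $K\colon(0,\infty)\to(0,\infty)$, $(e_j)$ has the *$K$-diagonal factorization property in $X$* if for every $\delta>0$ and every bounded linear $T\colon X\to X$ with $e_m^*(Te_j)=0$ for $m\ne j$ and $\inf_j|e_j^*(Te_j)|\ge\delta$, the identity on $X$ almost $K(\delta)$-factors through $T$. Sequences $(x_i)$, $(y_i)$ are *impartially $C$-equivalent* if $\frac1{\sqrt C}\|\sum a_iy_i\|\le\|\sum a_ix_i\|\le\sqrt C\,\|\sum a_iy_i\|$ for all finitely supported real $(a_i)$. $(e_j)$ is *$C$-strategically reproducible in $X$* if for every $\eta>0$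 Player II has a winning strategy in the following game. First Player I picks a partition $\mathbb N=N_1\cup N_2$. In turn $n$, Player I picks $\eta_n>0$, a finite-codimensional subspace $W_n\subset X$ and a $w^*$-closed finite-codimensional subspace $G_n\subset X^*$; then Player II picks $i_n\in\{1,2\}$, a finite set $E_n\subset N_{i_n}$ and non-negative reals $(\lambda_i^{(n)})_{i\in E_n}$, $(\mu_i^{(n)})_{i\in E_n}$ with $1-\eta<\sum_{i\in E_n}\lambda_i^{(n)}\mu_i^{(n)}<1+\eta$; then Player I picks signs $(\varepsilon_i^{(n)})_{i\in E_n}\in\{-1,1\}^{E_n}$. Put $x_n=\sum_{i\in E_n}\varepsilon_i^{(n)}\lambda_i^{(n)}e_i$ and $x_n^*=\sum_{i\in E_n}\varepsilon_i^{(n)}\mu_i^{(n)}e_i^*$. Player II wins if $(x_n)$ and $(e_n)$ are impartially $(C+\eta)$-equivalent, $(x_n^*)$ and $(e_n^*)$ are impartially $(C+\eta)$-equivalent, and $\mathrm{dist}(x_n,W_n)<\eta_n$, $\mathrm{dist}(x_n^*,G_n)<\eta_n$ for all $n$. **Theorem 3.4.** For each $k\in\mathbb N$ let $X_k$ be a Banach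 space with a normalized Schauder basis $(e_{(k,j)})_j$ and coordinate functionals $(e_{(k,j)}^*)_j$. Let $Z=\ell^\infty(X_k:k\in\mathbb N)$ be the space of bounded sequences $(x_k)$, $x_k\in X_k$, with the norm $\sup_k\|x_k\|$; regard $e_{(k,j)}$ as an element of $Z$ and $e_{(k,j)}^*$ as an element of $Z^*$ through the $k$-th coordinate. Assume that there are $C,\lambda\ge1$ and a map $K\colon(0,\infty)\to(0,\infty)$ such that for every $k\in\mathbb N$ 1. the basis constant of $(e_{(k,j)})_j$ in $X_k$ is at most $\lambda$; 2. $(e_{(k,j)})_j$ has the $K$-diagonal factorization property in $X_k$; 3. $(e_{(k,j)})_j$ is $C$-strategically reproducible in $X_k$ (that is, the array is simultaneously $C$-strategically reproducible in $Z$). Let $T\colon Z\to Z$ be bounded and linear with $$\delta=\inf_{k,j\in\mathbb N}\bigl|e_{(k,j)}^*(Te_{(k,j)})\bigr|>0 .$$ Then for each sequence $(\Omega_l)$ of infinite subsets of $\mathbb N$ there is an infinite $\Gamma\subset\mathbb N$ such that $\Gamma\cap\Omega_l$ is infinite for all $l\in\mathbb N$ and the identity on $Z_\Gamma=\ell^\infty(X_k:k\in\Gamma)$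 almost $\lambda C^2K(\delta)$-factors through $T$. If $C>1$, the identity on $Z_\Gamma$ moreover $\lambda C^2K(\delta)$-factors through $T$ (without $\varepsilon$) for the same $\Gamma$. -/

import Mathlib

open scoped ENNReal

noncomputable section

namespace LinftySum

/-- The sequences `x` and `y` (in possibly different normed spaces) are
impartially `C`-equivalent. -/
def ImpartiallyEquivalent {V W : Type*} [NormedAddCommGroup V] [NormedSpace ℝ V]
    [NormedAddCommGroup W] [NormedSpace ℝ W] (C : ℝ) (x : ℕ → V) (y : ℕ → W) : Prop :=
  ∀ (s : Finset ℕ) (a : ℕ → ℝ),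
    1 / √C * ‖∑ i ∈ s, a i • y i‖ ≤ ‖∑ i ∈ s, a i • x i‖ ∧
      ‖∑ i ∈ s, a i • x i‖ ≤ √C * ‖∑ i ∈ s, a i • y i‖

/-- The identity on `V` `c`-factors through the operator `T : U → U`: there are bounded operators
`B : V → U` and `A : U → V` with `A T B = I` and `‖A‖ ‖B‖ ≤ c`. -/
def IdFactorsThrough (V : Type*) {U : Type*} [NormedAddCommGroup V] [NormedSpace ℝ V]
    [NormedAddCommGroup U] [NormedSpace ℝ U] (c : ℝ) (T : U →L[ℝ] U) : Prop :=
  ∃ (A : U →L[ℝ] V) (B : V →L[ℝ] U),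
    ‖A‖ * ‖B‖ ≤ c ∧ A.comp (T.comp B) = ContinuousLinearMap.id ℝ V

/-- The identity on `V` almost `c`-factors through `T`. -/
def IdAlmostFactorsThrough (V : Type*) {U : Type*} [NormedAddCommGroup V] [NormedSpace ℝ V]
    [NormedAddCommGroup U] [NormedSpace ℝ U] (c : ℝ) (T : U →L[ℝ] U) : Prop :=
  ∀ ε : ℝ, 0 < ε → IdFactorsThrough V (c + ε) T

section Basis

variable {X : Type*} [NormedAddCommGroup X] [NormedSpace ℝ X]

/-- `T` is a diagonal operator with respect to the basis `e`. -/
def IsDiagonal (e : SchauderBasis ℝ X) (T : X →L[ℝ] X) : Prop :=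
  ∀ m j : ℕ, m ≠ j → e.coord m (T (e j)) = 0

/-- The basis `e` has the `K`-diagonal factorization property. -/
def DiagonalFactorizationProperty (e : SchauderBasis ℝ X) (K : ℝ → ℝ) : Prop :=
  ∀ δ : ℝ, 0 < δ → ∀ T : X →L[ℝ] X, IsDiagonal e T → (∀ j, δ ≤ |e.coord j (T (e j))|) →
    IdAlmostFactorsThrough X (K δ) T

variable (X) in
/-- What Player I plays in the first step of a turn: a tolerance `tol > 0`, a finite-codimensional
subspace `W` of `X` and a weak-star closed finite-codimensional subspace `G` of the dual. -/
structure SpaceMove where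
  tol : ℝ
  tol_pos : 0 < tol
  W : Submodule ℝ X
  W_cofinite : FiniteDimensional ℝ (X ⧸ W)
  G : Submodule ℝ (StrongDual ℝ X)
  G_cofinite : FiniteDimensional ℝ (StrongDual ℝ X ⧸ G)
  G_weakStar_closed :
    IsClosed ((fun f : WeakDual ℝ X => WeakDual.toStrongDual f) ⁻¹' (G : Set (StrongDual ℝ X)))

/-- What Player II plays in the second step of a turn: a finite set `E` and coefficients, of which
only those with index in `E` matter. -/
structure Response where
  E : Finset ℕ
  lam : ℕ → ℝ
  mu : ℕ → ℝ

/-- The rules for Player II, when Player I has chosen the partition `ℕ = N ∪ Nᶜ`. -/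
def Response.Legal (r : Response) (N : Set ℕ) (η : ℝ) : Prop :=
  ((r.E : Set ℕ) ⊆ N ∨ (r.E : Set ℕ) ⊆ Nᶜ) ∧
    (∀ i ∈ r.E, 0 ≤ r.lam i ∧ 0 ≤ r.mu i) ∧
    1 - η < ∑ i ∈ r.E, r.lam i * r.mu i ∧ ∑ i ∈ r.E, r.lam i * r.mu i < 1 + η

variable (X) in
/-- A strategy for Player II. His response in turn `n` is a function of everything Player I has
played so far: the partition `ℕ = N ∪ Nᶜ`, the spaces and tolerances of the turns `0, …, n`, and
the signs of the turns `0, …, n - 1`. Signs are recorded as functions on `ℕ`; only their values on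
the finite set played by Player II in the same turn are moves of the game, the other values are
irrelevant (Player II gains nothing from them, since he could fill them in by himself). -/
abbrev Strategy : Type _ :=
  (N : Set ℕ) → (n : ℕ) → (Fin (n + 1) → SpaceMove X) → (Fin n → ℕ → ℤˣ) → Response

/-- The response of Player II in turn `n`, when he follows `σ` and Player I plays the partition
`ℕ = N ∪ Nᶜ`, the moves `p 0, p 1, …` and the signs `ε 0, ε 1, …`. -/
def Strategy.response (σ : Strategy X) (N : Set ℕ) (p : ℕ → SpaceMove X) (ε : ℕ → ℕ → ℤˣ)
    (n : ℕ) : Response :=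
  σ N n (fun i => p i) (fun i => ε i)

/-- The vector `∑_{i ∈ E} ε_i λ_i e_i` produced in a turn. -/
def Response.vec (r : Response) (e : SchauderBasis ℝ X) (ε : ℕ → ℤˣ) : X :=
  ∑ i ∈ r.E, (((ε i : ℤ) : ℝ) * r.lam i) • e i

/-- The functional `∑_{i ∈ E} ε_i μ_i e_i^*` produced in a turn. -/
def Response.functional (r : Response) (e : SchauderBasis ℝ X) (ε : ℕ → ℤˣ) : StrongDual ℝ X :=
  ∑ i ∈ r.E, (((ε i : ℤ) : ℝ) * r.mu i) • e.coord i

/-- `σ` is a winning strategy for Player II in the game `Rep_{(X,e)}(C, η)`: against every play of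
Player I, all responses are legal and the resulting sequences satisfy the four conditions. -/
def Strategy.Wins (σ : Strategy X) (e : SchauderBasis ℝ X) (C η : ℝ) : Prop :=
  ∀ (N : Set ℕ) (p : ℕ → SpaceMove X) (ε : ℕ → ℕ → ℤˣ),
    (∀ n, (σ.response N p ε n).Legal N η) ∧
    ImpartiallyEquivalent (C + η) (fun n => (σ.response N p ε n).vec e (ε n)) (fun n => e n) ∧
    ImpartiallyEquivalent (C + η) (fun n => (σ.response N p ε n).functional e (ε n))
      (fun n => e.coord n) ∧
    (∀ n, Metric.infDist ((σ.response N p ε n).vec e (ε n)) (p n).W < (p n).tol) ∧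
    (∀ n, Metric.infDist ((σ.response N p ε n).functional e (ε n)) (p n).G < (p n).tol)

/-- The basis `e` is `C`-strategically reproducible in `X`. -/
def StrategicallyReproducible (e : SchauderBasis ℝ X) (C : ℝ) : Prop :=
  ∀ η : ℝ, 0 < η → ∃ σ : Strategy X, σ.Wins e C η

end Basis

section Sum

variable {X : ℕ → Type*} [∀ k, NormedAddCommGroup (X k)] [∀ k, NormedSpace ℝ (X k)]

/-- The array `(e_{(k,j)})` is simultaneously `C`-strategically reproducible. -/
def SimultaneouslyStrategicallyReproducible (e : ∀ k, SchauderBasis ℝ (X k)) (C : ℝ) : Prop :=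
  ∀ k, StrategicallyReproducible (e k) C

variable (X) in
/-- `ℓ^∞(X_k : k ∈ Γ)`, the bounded families with the supremum norm. -/
abbrev EllInfty (Γ : Set ℕ) : Type _ := lp (fun k : Γ => X k) ∞

/-- The diagonal entry `e^*_{(k,j)}(T e_{(k,j)})` of an operator `T` on `ℓ^∞(X_k : k ∈ ℕ)`, where
`X_k` and its dual are embedded through the `k`-th coordinate. -/
def diagEntry (e : ∀ k, SchauderBasis ℝ (X k)) (T : lp X ∞ →L[ℝ] lp X ∞) (k j : ℕ) : ℝ :=
  (e k).coord j ((T (lp.single ∞ k (e k j)) : ∀ i, X i) k)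

end Sum

end LinftySum

end

open LinftySum

open scoped Topology
open Filter

/-! Write `T` as a matrix of blocks `X l → X k`. The strategic games of all `k` are played
simultaneously, the turns `(k, j)` ordered by `Nat.pair`. Player I splits `ℕ` by the sign of the
diagonal of the `k`-th diagonal block, picks subspaces that nearly annihilate all that was produced
before, and picks signs that keep the new diagonal entry large (`exists_almost_diagonal_systems`).
The resulting vectors `x k j` and functionals `f k j` give operators `B k`, `A k` for which `A k ∘
block T k k ∘ B k` is close to a diagonal operator with entries of modulus at least `(1 - η) * δ`;
the diagonal factorization property then recovers the identity of `X k`.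

The off-diagonal blocks are small on each single coordinate, but a functional on an `ℓ^∞`-sum need
not be the sum of its coordinate restrictions. This is repaired by passing to `Γ`: in an uncountable
almost disjoint family, a given functional can exceed a given `ε` at infinity on only finitely many
members, so countably many functionals are all regular on some member (`exists_regularOn`). On such
a `Γ` the errors can be summed, and a Neumann series finishes
(`idFactorsThrough_of_almost_diagonal`).

Impartial equivalence costs `√(C + η)` for each of `A k` and `B k`, so every constant above `lam * C
* K δ` is reached. For `C > 1` this is strictly below `lam * C ^ 2 * K δ`, which is why no `ε` is
needed there. -/

namespace LinftySum

/-! ### Operators and disjointly supported vectors in `ℓ^∞`-sums. -/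

section CoordinateTools

variable {ι : Type*} {Y : ι → Type*} [∀ i, NormedAddCommGroup (Y i)]

/-- A uniformly bounded family of operators into the coordinates defines an operator into the
`ℓ^∞`-sum. -/
theorem exists_operator_of_coordinates [∀ i, NormedSpace ℝ (Y i)] {V : Type*}
    [NormedAddCommGroup V] [NormedSpace ℝ V] (L : ∀ i, V →L[ℝ] Y i) {c : ℝ} (hc : 0 ≤ c) (hL : ∀ i, ‖L i‖ ≤ c) :
    ∃ M : V →L[ℝ] lp Y ∞, ‖M‖ ≤ c ∧ ∀ v i, (M v : ∀ i, Y i) i = L i v := by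
  have hbd : ∀ v i, ‖L i v‖ ≤ c * ‖v‖ := fun v i =>
    ((L i).le_opNorm v).trans (mul_le_mul_of_nonneg_right (hL i) (norm_nonneg v))
  have hmem : ∀ v, Memℓp (fun i => L i v) ∞ := fun v =>
    memℓp_infty ⟨c * ‖v‖, by rintro _ ⟨i, rfl⟩; exact hbd v i⟩
  let M₀ : V →ₗ[ℝ] lp Y ∞ :=
    { toFun := fun v => ⟨fun i => L i v, hmem v⟩
      map_add' := fun v w => by ext i; exact map_add (L i) v w
      map_smul' := fun a v => by ext i; exact map_smul (L i) a v }
  refine ⟨M₀.mkContinuous c fun v => ?_, M₀.mkContinuous_norm_le hc _, fun v i => rfl⟩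
  exact lp.norm_le_of_forall_le (by positivity) fun i => hbd v i

theorem norm_sum_le_one_of_disjoint {κ : Type*} (S : Finset κ) (z : κ → lp Y ∞)
    (hz : ∀ α ∈ S, ‖z α‖ ≤ 1)
    (hdis : ∀ α ∈ S, ∀ β ∈ S, α ≠ β → ∀ i, (z α : ∀ i, Y i) i = 0 ∨ (z β : ∀ i, Y i) i = 0) :
    ‖∑ α ∈ S, z α‖ ≤ 1 := by
  refine lp.norm_le_of_forall_le zero_le_one fun i => ?_
  rw [lp.coeFn_sum, Finset.sum_apply]
  by_cases h : ∃ α ∈ S, (z α : ∀ i, Y i) i ≠ 0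
  · obtain ⟨α, hα, hne⟩ := h
    rw [Finset.sum_eq_single_of_mem α hα fun β hβ hβα =>
      (hdis β hβ α hα hβα i).resolve_right hne]
    exact (lp.norm_apply_le_norm ENNReal.top_ne_zero (z α) i).trans (hz α hα)
  · push Not at h
    rw [Finset.sum_eq_zero h, norm_zero]
    exact zero_le_one

end CoordinateTools

/-! ### Almost disjoint sets and regularity of functionals. -/

/-- Every sequence of infinite sets admits an uncountable almost disjoint family of sets, each of
which meets all of the given sets in an infinite set. -/
theorem exists_almostDisjoint (Ω : ℕ → Set ℕ) (hΩ : ∀ l, (Ω l).Infinite) :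
    ∃ Γ : (ℕ → Bool) → Set ℕ, (∀ α l, (Γ α ∩ Ω l).Infinite) ∧
      ∀ α β, α ≠ β → (Γ α ∩ Γ β).Finite := by
  obtain ⟨h, hh_inj, hh_mem⟩ : ∃ h : ℕ → ℕ, h.Injective ∧ ∀ n, h n ∈ Ω n.unpair.1 := by
    choose next hmem hlt using fun l n => (hΩ l).exists_gt n
    let h : ℕ → ℕ := fun n =>
      Nat.rec (next (Nat.unpair 0).1 0) (fun m r => next (Nat.unpair (m + 1)).1 r) n
    refine ⟨h, (strictMono_nat_of_lt_succ fun n => hlt _ _).injective, fun n => ?_⟩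
    cases n with
    | zero => exact hmem _ _
    | succ n => exact hmem _ _
  -- Nodes of the binary tree: `code α n` encodes the first `n` bits of `α`, so two distinct
  -- branches share only finitely many nodes.
  let code : (ℕ → Bool) → ℕ → ℕ := fun α n => Encodable.encode ((List.range n).map α)
  have hcode : ∀ α β n m, code α n = code β m → n = m ∧ ∀ i < n, α i = β i := by
    intro α β n m hc
    have hl := Encodable.encode_injective hc
    have hnm : n = m := by simpa using congrArg List.length hl
    subst hnm
    refine ⟨rfl, fun i hi => ?_⟩
    exact List.map_inj_left.1 hl i (List.mem_range.2 hi)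
  -- The restriction `l ≤ n` is what makes intersections finite: two branches share only nodes of
  -- bounded level `n`, and then `l` is bounded too.
  refine ⟨fun α => {x | ∃ l n, l ≤ n ∧ x = h (Nat.pair l (code α n))}, fun α l => ?_,
    fun α β hαβ => ?_⟩
  · refine Set.infinite_of_injective_forall_mem (f := fun n => h (Nat.pair l (code α (l + n))))
      (fun n m hnm => ?_) fun n => ⟨⟨l, l + n, Nat.le_add_right l n, rfl⟩, ?_⟩
    · have := (hcode _ _ _ _ (Nat.pair_eq_pair.1 (hh_inj hnm)).2).1
      omega
    · simpa using hh_mem (Nat.pair l (code α (l + n)))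
  · obtain ⟨i, hi⟩ := Function.ne_iff.1 hαβ
    refine (((Finset.range (i + 1)) ×ˢ (Finset.range (i + 1))).image
      fun p : ℕ × ℕ => h (Nat.pair p.1 (code α p.2))).finite_toSet.subset ?_
    rintro x ⟨⟨l, n, hln, rfl⟩, ⟨l', n', -, hx⟩⟩
    have hni : n ≤ i := by
      by_contra hlt
      exact hi ((hcode _ _ _ _ (Nat.pair_eq_pair.1 (hh_inj hx)).2).2 i (not_le.1 hlt))
    simp only [Finset.coe_image, Set.mem_image, Finset.mem_coe, Finset.mem_product,
      Finset.mem_range]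
    exact ⟨(l, n), ⟨by simp; omega, by simp; omega⟩, rfl⟩

section Regular

variable {X : ℕ → Type*} [∀ k, NormedAddCommGroup (X k)] [∀ k, NormedSpace ℝ (X k)]

/-- On vectors supported in `Γ`, the functional `φ` is the sum of its restrictions to the
coordinates. -/
def RegularOn (φ : StrongDual ℝ (lp X ∞)) (Γ : Set ℕ) : Prop :=
  ∀ z : lp X ∞, (∀ k ∉ Γ, (z : ∀ i, X i) k = 0) →
    HasSum (fun k => φ (lp.single ∞ k ((z : ∀ i, X i) k))) (φ z)

/-- The functional `φ` exceeds `ε` on the part of the unit ball supported in `Γ \ F`, for every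
finite set `F`. -/
def ConcentratesOn (φ : StrongDual ℝ (lp X ∞)) (ε : ℝ) (Γ : Set ℕ) : Prop :=
  ∀ F : Set ℕ, F.Finite → ∃ z : lp X ∞, ‖z‖ ≤ 1 ∧
    (∀ k, k ∉ Γ ∨ k ∈ F → (z : ∀ i, X i) k = 0) ∧ ε < φ z

/-- Take `n > ‖φ‖ / ε` members and delete the finite union `F` of their pairwise intersections. The
witnesses become disjointly supported, so their sum stays in the unit ball while `φ` is at least `n
* ε` on it. -/
theorem finite_concentratesOn {κ : Type*} (φ : StrongDual ℝ (lp X ∞)) {ε : ℝ} (hε : 0 < ε)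
    (Γ : κ → Set ℕ) (hΓ : ∀ α β, α ≠ β → (Γ α ∩ Γ β).Finite) :
    {α | ConcentratesOn φ ε (Γ α)}.Finite := by
  by_contra hinf
  obtain ⟨n, hn⟩ := exists_nat_gt (‖φ‖ / ε)
  obtain ⟨S, hS, hcard⟩ := Set.Infinite.exists_subset_card_eq hinf n
  let F : Set ℕ := ⋃ α ∈ S, ⋃ β ∈ S, ⋃ (_ : α ≠ β), Γ α ∩ Γ β
  have hF : F.Finite := S.finite_toSet.biUnion fun α _ => S.finite_toSet.biUnion fun β _ =>
    Set.finite_iUnion fun h => hΓ α β h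
  have hz : ∀ α : κ, ∃ z : lp X ∞, α ∈ S → ‖z‖ ≤ 1 ∧
      (∀ k, k ∉ Γ α ∨ k ∈ F → (z : ∀ i, X i) k = 0) ∧ ε < φ z := by
    intro α
    by_cases hα : α ∈ S
    · obtain ⟨z, hz⟩ := hS hα F hF
      exact ⟨z, fun _ => hz⟩
    · exact ⟨0, fun h => absurd h hα⟩
  choose z hz using hz
  have hnorm : ‖∑ α ∈ S, z α‖ ≤ 1 := by
    refine norm_sum_le_one_of_disjoint S z (fun α hα => (hz α hα).1) fun α hα β hβ hαβ i => ?_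
    by_cases hi : i ∈ Γ α
    · by_cases hi' : i ∈ Γ β
      · left
        refine (hz α hα).2.1 i (Or.inr ?_)
        simp only [F, Set.mem_iUnion]
        exact ⟨α, hα, β, hβ, hαβ, hi, hi'⟩
      · exact Or.inr ((hz β hβ).2.1 i (Or.inl hi'))
    · exact Or.inl ((hz α hα).2.1 i (Or.inl hi))
  have h1 : n * ε ≤ φ (∑ α ∈ S, z α) := by
    rw [map_sum, ← hcard, ← nsmul_eq_mul]
    exact Finset.card_nsmul_le_sum S _ _ fun α hα => (hz α hα).2.2.le
  have h2 : φ (∑ α ∈ S, z α) ≤ ‖φ‖ := by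
    refine (le_abs_self _).trans ((φ.le_opNorm _).trans ?_)
    exact mul_le_of_le_one_right (norm_nonneg _) hnorm
  rw [div_lt_iff₀ hε] at hn
  linarith

/-- Once a partial sum covers `F`, the remainder of `z` is supported in `Γ \ F` and has norm at most
`‖z‖`, so `φ` is small on it. -/
theorem regularOn_of_not_concentratesOn (φ : StrongDual ℝ (lp X ∞)) (Γ : Set ℕ)
    (h : ∀ m : ℕ, ¬ ConcentratesOn φ (1 / ((m : ℝ) + 1)) Γ) : RegularOn φ Γ := by
  intro z hz
  rw [HasSum, SummationFilter.unconditional_filter, Metric.tendsto_atTop]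
  intro ε hε
  obtain ⟨m, hm⟩ := exists_nat_one_div_lt (show 0 < ε / (‖z‖ + 1) by positivity)
  have hnot := h m
  simp only [ConcentratesOn, not_forall, not_exists, not_and, not_lt] at hnot
  obtain ⟨F, hF, hbd⟩ := hnot
  refine ⟨hF.toFinset, fun F' hF' => ?_⟩
  set w : lp X ∞ := z - ∑ k ∈ F', lp.single ∞ k ((z : ∀ i, X i) k) with hw
  have hwk : ∀ k, (w : ∀ i, X i) k = if k ∈ F' then 0 else (z : ∀ i, X i) k := by
    intro k
    rw [hw, lp.coeFn_sub, Pi.sub_apply, lp.coeFn_sum, Finset.sum_apply]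
    simp only [lp.coeFn_single, Finset.sum_pi_single]
    split_ifs <;> simp
  have hwn : ‖w‖ ≤ ‖z‖ := by
    refine lp.norm_le_of_forall_le (norm_nonneg _) fun k => ?_
    rw [hwk]
    split_ifs
    · simp
    · exact lp.norm_apply_le_norm ENNReal.top_ne_zero z k
  have hw0 : ∀ k, k ∉ Γ ∨ k ∈ F → (w : ∀ i, X i) k = 0 := by
    intro k hk
    rw [hwk]
    split_ifs with hkF
    · rfl
    · rcases hk with hk | hk
      · exact hz k hk
      · exact absurd (hF' (hF.mem_toFinset.2 hk)) hkF
  -- Non-concentration bounds `φ` from above only; `s = 1` and `s = -1` give both sides. Dividing by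
  -- `‖z‖ + 1` avoids the case `z = 0`.
  have key : ∀ s : ℝ, |s| ≤ 1 → s * φ w ≤ (‖z‖ + 1) * (1 / ((m : ℝ) + 1)) := by
    intro s hs
    have hpos : 0 < ‖z‖ + 1 := by positivity
    have := hbd ((s / (‖z‖ + 1)) • w) ?_ ?_
    · rw [map_smul, smul_eq_mul, div_mul_eq_mul_div, div_le_iff₀ hpos] at this
      linarith
    · rw [norm_smul, Real.norm_eq_abs, abs_div, abs_of_pos hpos, div_mul_eq_mul_div,
        div_le_one hpos]
      nlinarith [norm_nonneg w]
    · intro k hk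
      rw [lp.coeFn_smul, Pi.smul_apply, hw0 k hk, smul_zero]
  have hlt : (‖z‖ + 1) * (1 / ((m : ℝ) + 1)) < ε := by
    rw [lt_div_iff₀ (by positivity)] at hm
    linarith
  rw [← map_sum, dist_comm, Real.dist_eq, ← map_sub, ← hw, abs_lt]
  constructor
  · linarith [key (-1) (by simp)]
  · linarith [key 1 (by simp)]

/-- Given countably many functionals on the `ℓ^∞`-sum, there is a set `Γ`, large with respect to
the given infinite sets, on which all of them are regular. -/
theorem exists_regularOn {ι : Type*} [Countable ι] (φ : ι → StrongDual ℝ (lp X ∞))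
    (Ω : ℕ → Set ℕ) (hΩ : ∀ l, (Ω l).Infinite) :
    ∃ Γ : Set ℕ, (∀ l, (Γ ∩ Ω l).Infinite) ∧ ∀ i, RegularOn (φ i) Γ := by
  obtain ⟨Γ, hΓΩ, hΓ⟩ := exists_almostDisjoint Ω hΩ
  have hcount : (⋃ i, ⋃ m : ℕ, {α | ConcentratesOn (φ i) (1 / ((m : ℝ) + 1)) (Γ α)}).Countable :=
    Set.countable_iUnion fun i => Set.countable_iUnion fun m =>
      (finite_concentratesOn (φ i) (by positivity) Γ hΓ).countable
  have huniv : ¬ (Set.univ : Set (ℕ → Bool)).Countable := by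
    rw [Set.countable_univ_iff]
    intro hc
    obtain ⟨f, hf⟩ := exists_surjective_nat (ℕ → Bool)
    obtain ⟨n, hn⟩ := hf fun n => !(f n n)
    simpa using congrFun hn n
  obtain ⟨α, -, hα⟩ := Set.not_subset.1 fun hsub => huniv (hcount.mono hsub)
  simp only [Set.mem_iUnion, not_exists] at hα
  exact ⟨Γ α, hΓΩ α, fun i => regularOn_of_not_concentratesOn _ _ fun m => hα i m⟩

end Regular

/-! ### Operators defined by sequences dominated by a basis or its coordinate functionals. -/

section BasisOperators

variable {X : Type*} [NormedAddCommGroup X] [NormedSpace ℝ X]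

theorem coord_apply_basis (e : SchauderBasis ℝ X) (i j : ℕ) :
    e.coord i (e j) = if i = j then 1 else 0 := by
  rw [e.ortho]
  simp [Pi.single_apply]

theorem norm_coord_le {e : SchauderBasis ℝ X} (he : ∀ j, ‖e j‖ = 1) {lam : ℝ}
    (hproj : ∀ n, ‖SchauderBasis.proj e n‖ ≤ lam) (j : ℕ) : ‖e.coord j‖ ≤ 2 * lam := by
  have hlam : 0 ≤ lam := (norm_nonneg _).trans (hproj 0)
  refine ContinuousLinearMap.opNorm_le_bound _ (by positivity) fun v => ?_
  have h1 : e.coord j v • e j =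
      SchauderBasis.proj e (j + 1) v - SchauderBasis.proj e j v := by
    rw [SchauderBasis.proj_apply, SchauderBasis.proj_apply, Finset.sum_range_succ,
      add_sub_cancel_left]
  calc ‖e.coord j v‖ = ‖e.coord j v • e j‖ := by rw [norm_smul, he, mul_one]
    _ ≤ ‖SchauderBasis.proj e (j + 1) v‖ + ‖SchauderBasis.proj e j v‖ := by
      rw [h1]; exact norm_sub_le _ _
    _ ≤ lam * ‖v‖ + lam * ‖v‖ :=
      add_le_add (ContinuousLinearMap.le_of_opNorm_le _ (hproj _) v)
        (ContinuousLinearMap.le_of_opNorm_le _ (hproj _) v)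
    _ = 2 * lam * ‖v‖ := by ring

theorem exists_limit_operator {Y : Type*} [NormedAddCommGroup Y] [NormedSpace ℝ Y]
    [CompleteSpace Y] (g : ℕ → X →L[ℝ] Y) {c : ℝ} (hc : 0 ≤ c)
    (hg : ∀ n v, ‖g n v‖ ≤ c * ‖v‖) (hcauchy : ∀ v, CauchySeq fun n => g n v) :
    ∃ G : X →L[ℝ] Y, ‖G‖ ≤ c ∧ ∀ v, Tendsto (fun n => g n v) atTop (𝓝 (G v)) := by
  choose G hG using fun v => cauchySeq_tendsto_of_complete (hcauchy v)
  let G₀ : X →ₗ[ℝ] Y :=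
    { toFun := G
      map_add' := fun v w => tendsto_nhds_unique (hG (v + w)) (by
        simpa using (hG v).add (hG w))
      map_smul' := fun a v => tendsto_nhds_unique (hG (a • v)) (by
        simpa using (hG v).const_smul a) }
  exact ⟨G₀.mkContinuous c fun v => le_of_tendsto' (hG v).norm fun n => hg n v,
    G₀.mkContinuous_norm_le hc _, hG⟩

/-- By duality: a norming functional `g` turns the sum into `(∑ g (e j) • f j) v`, and the same
combination of coordinate functionals is `g ∘ proj e n`, of norm at most `lam`. This is the source
of the factor `lam` in the theorem. -/
theorem norm_sum_functional_smul_le (e : SchauderBasis ℝ X) {lam : ℝ}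
    (hproj : ∀ n, ‖SchauderBasis.proj e n‖ ≤ lam) (f : ℕ → StrongDual ℝ X) {c : ℝ} (hc : 0 ≤ c)
    (hf : ∀ (s : Finset ℕ) (a : ℕ → ℝ), ‖∑ i ∈ s, a i • f i‖ ≤ c * ‖∑ i ∈ s, a i • e.coord i‖)
    (n : ℕ) (v : X) : ‖∑ j ∈ Finset.range n, f j v • e j‖ ≤ c * lam * ‖v‖ := by
  obtain ⟨g, hg, hgv⟩ := exists_dual_vector'' ℝ (∑ j ∈ Finset.range n, f j v • e j)
  have h1 : g (∑ j ∈ Finset.range n, f j v • e j) =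
      (∑ j ∈ Finset.range n, g (e j) • f j) v := by
    simp [map_sum, mul_comm]
  have h2 : ∑ j ∈ Finset.range n, g (e j) • e.coord j =
      g.comp (SchauderBasis.proj e n) := by
    ext w
    simp [SchauderBasis.proj_apply, map_sum, mul_comm]
  have h3 : ‖∑ j ∈ Finset.range n, g (e j) • f j‖ ≤ c * lam := by
    refine (hf _ _).trans (mul_le_mul_of_nonneg_left ?_ hc)
    rw [h2]
    refine (ContinuousLinearMap.opNorm_comp_le _ _).trans ?_
    exact (mul_le_of_le_one_left (norm_nonneg _) hg).trans (hproj n)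
  rw [h1] at hgv
  have h4 : ‖∑ j ∈ Finset.range n, f j v • e j‖ = (∑ j ∈ Finset.range n, g (e j) • f j) v :=
    hgv.symm
  rw [h4]
  exact (le_abs_self _).trans (ContinuousLinearMap.le_of_opNorm_le _ h3 v)

variable [CompleteSpace X]

/-- A sequence dominated by the basis is the image of the basis under a bounded operator. -/
theorem exists_synthesis (e : SchauderBasis ℝ X) {lam : ℝ}
    (hproj : ∀ n, ‖SchauderBasis.proj e n‖ ≤ lam) (x : ℕ → X) {c : ℝ} (hc : 0 ≤ c)
    (hx : ∀ (s : Finset ℕ) (a : ℕ → ℝ), ‖∑ i ∈ s, a i • x i‖ ≤ c * ‖∑ i ∈ s, a i • e i‖) :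
    ∃ B : X →L[ℝ] X, ‖B‖ ≤ c ∧
      ∀ v, Tendsto (fun n => ∑ j ∈ Finset.range n, e.coord j v • x j) atTop (𝓝 (B v)) := by
  have hcauchy : ∀ v, CauchySeq fun n => ∑ j ∈ Finset.range n, e.coord j v • x j := by
    intro v
    have h0 : CauchySeq fun n => SchauderBasis.proj e n v := (e.tendsto_proj v).cauchySeq
    rw [Metric.cauchySeq_iff'] at h0 ⊢
    intro ε hε
    obtain ⟨N, hN⟩ := h0 (ε / (c + 1)) (by positivity)
    refine ⟨N, fun n hn => ?_⟩
    have h1 := hN n hn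
    rw [dist_eq_norm, SchauderBasis.proj_apply, SchauderBasis.proj_apply,
      ← Finset.sum_Ico_eq_sub _ hn, lt_div_iff₀ (by positivity)] at h1
    rw [dist_eq_norm, ← Finset.sum_Ico_eq_sub _ hn]
    refine (hx _ _).trans_lt ?_
    nlinarith [norm_nonneg (∑ i ∈ Finset.Ico N n, e.coord i v • e i)]
  -- In the limit the factor `lam` disappears, since `proj e n v` tends to `v`. The bound `c * lam`
  -- is used below only to construct `B`.
  have hlim : ∀ v, ∃ y, Tendsto (fun n => ∑ j ∈ Finset.range n, e.coord j v • x j)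
      atTop (𝓝 y) ∧ ‖y‖ ≤ c * ‖v‖ := by
    intro v
    obtain ⟨y, hy⟩ := cauchySeq_tendsto_of_complete (hcauchy v)
    refine ⟨y, hy, le_of_tendsto_of_tendsto' hy.norm ((e.tendsto_proj v).norm.const_mul c) ?_⟩
    intro n
    rw [SchauderBasis.proj_apply]
    exact hx _ _
  obtain ⟨B, -, hB⟩ := exists_limit_operator
    (fun n => ∑ j ∈ Finset.range n, (e.coord j).smulRight (x j)) (c := c * lam)
    (mul_nonneg hc ((norm_nonneg _).trans (hproj 0))) (fun n v => by
      rw [_root_.sum_apply]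
      simp only [ContinuousLinearMap.smulRight_apply]
      refine (hx _ _).trans ?_
      rw [mul_assoc, ← SchauderBasis.proj_apply]
      exact mul_le_mul_of_nonneg_left (ContinuousLinearMap.le_of_opNorm_le _ (hproj n) v) hc)
    (fun v => by
      simpa only [_root_.sum_apply, ContinuousLinearMap.smulRight_apply]
        using hcauchy v)
  simp only [_root_.sum_apply, ContinuousLinearMap.smulRight_apply] at hB
  refine ⟨B, ContinuousLinearMap.opNorm_le_bound _ hc fun v => ?_, hB⟩
  obtain ⟨y, hy, hyn⟩ := hlim v
  rwa [tendsto_nhds_unique (hB v) hy]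

/-- A sequence of functionals dominated by the coordinate functionals and eventually small on each
basis vector gives the coordinates of a bounded operator. -/
theorem exists_analysis (e : SchauderBasis ℝ X) {lam : ℝ}
    (hproj : ∀ n, ‖SchauderBasis.proj e n‖ ≤ lam) (he : ∀ j, ‖e j‖ = 1)
    (f : ℕ → StrongDual ℝ X) {c : ℝ} (hc : 0 ≤ c)
    (hf : ∀ (s : Finset ℕ) (a : ℕ → ℝ), ‖∑ i ∈ s, a i • f i‖ ≤ c * ‖∑ i ∈ s, a i • e.coord i‖)
    (hsum : ∀ i, Summable fun j => |f j (e i)|) :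
    ∃ A : X →L[ℝ] X, ‖A‖ ≤ c * lam ∧
      ∀ v, Tendsto (fun n => ∑ j ∈ Finset.range n, f j v • e j) atTop (𝓝 (A v)) := by
  have hlam : 0 ≤ lam := (norm_nonneg _).trans (hproj 0)
  let g : ℕ → X →L[ℝ] X := fun n => ∑ j ∈ Finset.range n, (f j).smulRight (e j)
  have hg : ∀ n v, g n v = ∑ j ∈ Finset.range n, f j v • e j := fun n v => by
    simp [g]
  have hgn : ∀ n v, ‖g n v‖ ≤ c * lam * ‖v‖ := fun n v => by
    rw [hg]; exact norm_sum_functional_smul_le e hproj f hc hf n v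
  -- Domination alone only bounds the partial sums. Summability of `f j (e i)` gives convergence on
  -- basis vectors, and the uniform bound extends it to all of `X` by density.
  have hbasis : ∀ i, CauchySeq fun n => g n (e i) := by
    intro i
    have : Summable fun j => f j (e i) • e j := by
      refine Summable.of_norm ?_
      simpa [norm_smul, he] using hsum i
    simpa only [hg] using this.hasSum.tendsto_sum_nat.cauchySeq
  have hfin : ∀ m v, CauchySeq fun n => g n (SchauderBasis.proj e m v) := by
    intro m v
    simp only [SchauderBasis.proj_apply, map_sum, map_smul]
    induction m with
    | zero => simpa using cauchySeq_const (0 : X)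
    | succ m ih =>
      simp only [Finset.sum_range_succ]
      obtain ⟨y, hy⟩ := cauchySeq_tendsto_of_complete (hbasis m)
      exact ih.add (hy.const_smul _).cauchySeq
  obtain ⟨A, hA, hlim⟩ := exists_limit_operator g (mul_nonneg hc hlam) hgn fun v => by
    rw [Metric.cauchySeq_iff']
    intro ε hε
    have hpos : 0 < c * lam + 1 := by positivity
    obtain ⟨m, hm⟩ := (((e.tendsto_proj v).eventually
      (Metric.ball_mem_nhds v (show 0 < ε / (4 * (c * lam + 1)) by positivity)))).exists
    obtain ⟨N, hN⟩ := Metric.cauchySeq_iff'.1 (hfin m v) (ε / 2) (by positivity)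
    refine ⟨N, fun n hn => ?_⟩
    have h1 := hN n hn
    rw [dist_comm, dist_eq_norm, lt_div_iff₀ (by positivity)] at hm
    have h2 : ∀ k, dist (g k v) (g k (SchauderBasis.proj e m v)) ≤ ε / 4 := by
      intro k
      rw [dist_eq_norm, ← map_sub]
      refine (hgn k _).trans ?_
      nlinarith [norm_nonneg (v - SchauderBasis.proj e m v)]
    have h3 := dist_triangle4 (g n v) (g n (SchauderBasis.proj e m v))
      (g N (SchauderBasis.proj e m v)) (g N v)
    have h4 := h2 N
    rw [dist_comm] at h4
    linarith [h2 n]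
  exact ⟨A, hA, fun v => by simpa only [hg] using hlim v⟩

end BasisOperators

/-! ### The games: recursion, signs, and moves of Player I. -/

/-- Well-founded recursion along `m`. The history `h` is a total function that agrees with `d` only
at indices of smaller `m` and is arbitrary elsewhere, so `R` needs no dependent domain. -/
theorem exists_recursive {ι : Type*} {D : ι → Type*} [∀ i, Nonempty (D i)] (m : ι → ℕ)
    (R : ∀ i, (∀ s, D s) → D i → Prop) (hR : ∀ i h, ∃ d, R i h d) :
    ∃ d : ∀ i, D i, ∀ i, ∃ h : ∀ s, D s, (∀ s, m s < m i → h s = d s) ∧ R i h (d i) := by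
  classical
  choose F hF using hR
  have wf : WellFounded fun s i : ι => m s < m i := InvImage.wf m wellFounded_lt
  let step : ∀ i, (∀ s, m s < m i → D s) → D i := fun i rec =>
    F i fun s => if hs : m s < m i then rec s hs else Classical.arbitrary _
  refine ⟨fun i => wf.fix step i, fun i =>
    ⟨fun s => if m s < m i then wf.fix step s else Classical.arbitrary _, fun s hs => if_pos hs, ?_⟩⟩
  change R i _ (wf.fix step i)
  rw [wf.fix_eq]
  exact hF i _

/-- Suitable signs make a quadratic form at least as large as its trace. -/
theorem exists_signs_trace_le (E : Finset ℕ) (m : ℕ → ℕ → ℝ) :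
    ∃ ε : ℕ → ℤˣ, ∑ i ∈ E, m i i ≤
      ∑ i ∈ E, ∑ j ∈ E, (((ε i : ℤ) : ℝ) * ((ε j : ℤ) : ℝ)) * m i j := by
  induction E using Finset.induction_on with
  | empty => exact ⟨1, by simp⟩
  | insert a E ha ih =>
    obtain ⟨ε, hε⟩ := ih
    -- A new index contributes its diagonal entry, as `u * u = 1`, plus the cross term `u * b`; `u`
    -- is chosen to make the latter non-negative.
    set b := ∑ i ∈ E, ((ε i : ℤ) : ℝ) * (m a i + m i a) with hb
    obtain ⟨u, hu⟩ : ∃ u : ℤˣ, 0 ≤ ((u : ℤ) : ℝ) * b := by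
      rcases le_total 0 b with h | h
      · exact ⟨1, by simpa using h⟩
      · exact ⟨-1, by simpa using h⟩
    have huu : ((u : ℤ) : ℝ) * ((u : ℤ) : ℝ) = 1 := by
      rcases Int.units_eq_one_or u with h | h <;> simp [h]
    refine ⟨Function.update ε a u, ?_⟩
    have hne : ∀ i ∈ E, Function.update ε a u i = ε i := fun i hi =>
      Function.update_of_ne (fun h : i = a => ha (h ▸ hi)) _ _
    rw [Finset.sum_insert ha, Finset.sum_insert ha, Finset.sum_insert ha]
    have h1 : ∑ j ∈ E, (((Function.update ε a u a : ℤ) : ℝ) *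
        ((Function.update ε a u j : ℤ) : ℝ)) * m a j =
        ((u : ℤ) : ℝ) * ∑ j ∈ E, ((ε j : ℤ) : ℝ) * m a j := by
      rw [Finset.mul_sum]
      refine Finset.sum_congr rfl fun j hj => ?_
      rw [hne j hj, Function.update_self]
      ring
    have h2 : ∑ i ∈ E, ∑ j ∈ insert a E, (((Function.update ε a u i : ℤ) : ℝ) *
        ((Function.update ε a u j : ℤ) : ℝ)) * m i j =
        ((u : ℤ) : ℝ) * (∑ i ∈ E, ((ε i : ℤ) : ℝ) * m i a) +
          ∑ i ∈ E, ∑ j ∈ E, (((ε i : ℤ) : ℝ) * ((ε j : ℤ) : ℝ)) * m i j := by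
      rw [Finset.mul_sum, ← Finset.sum_add_distrib]
      refine Finset.sum_congr rfl fun i hi => ?_
      rw [Finset.sum_insert ha, hne i hi, Function.update_self]
      congr 1
      · ring
      · exact Finset.sum_congr rfl fun j hj => by rw [hne j hj]
    have h3 : b = (∑ i ∈ E, ((ε i : ℤ) : ℝ) * m a i) + ∑ i ∈ E, ((ε i : ℤ) : ℝ) * m i a := by
      rw [hb, ← Finset.sum_add_distrib]
      exact Finset.sum_congr rfl fun i _ => by ring
    rw [h1, h2, Function.update_self, huu]
    rw [h3] at hu
    linarith

section Moves

variable {X : Type*} [NormedAddCommGroup X] [NormedSpace ℝ X]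

/-- The move consisting of the common kernel of finitely many functionals and the annihilator of
finitely many vectors. -/
noncomputable def SpaceMove.ofFinite (tol : ℝ) (htol : 0 < tol) (Φ : Finset (StrongDual ℝ X))
    (V : Finset X) : SpaceMove X where
  tol := tol
  tol_pos := htol
  W := LinearMap.ker (LinearMap.pi fun φ : Φ => (φ.1 : X →L[ℝ] ℝ).toLinearMap)
  W_cofinite := (LinearMap.quotKerEquivRange _).symm.finiteDimensional
  G := LinearMap.ker (LinearMap.pi fun v : V =>
    (ContinuousLinearMap.apply ℝ ℝ v.1 : StrongDual ℝ X →L[ℝ] ℝ).toLinearMap)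
  G_cofinite := (LinearMap.quotKerEquivRange _).symm.finiteDimensional
  G_weakStar_closed := by
    have : ((fun f : WeakDual ℝ X => WeakDual.toStrongDual f) ⁻¹'
        (LinearMap.ker (LinearMap.pi fun v : V =>
          (ContinuousLinearMap.apply ℝ ℝ v.1 : StrongDual ℝ X →L[ℝ] ℝ).toLinearMap) :
            Set (StrongDual ℝ X))) = ⋂ v : V, {f : WeakDual ℝ X | f v.1 = 0} := by
      ext f
      simp only [Set.mem_preimage, SetLike.mem_coe, LinearMap.mem_ker, Set.mem_iInter,
        Set.mem_ofPred_eq, funext_iff]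
      rfl
    rw [this]
    exact isClosed_iInter fun v => isClosed_eq (WeakDual.eval_continuous v.1) continuous_const

theorem abs_le_of_infDist_ofFinite_W {tol : ℝ} (htol : 0 < tol) {Φ : Finset (StrongDual ℝ X)}
    {V : Finset X} {x : X} (h : Metric.infDist x (SpaceMove.ofFinite tol htol Φ V).W < tol)
    {φ : StrongDual ℝ X} (hφ : φ ∈ Φ) : |φ x| ≤ ‖φ‖ * tol := by
  obtain ⟨w, hw, hxw⟩ := (Metric.infDist_lt_iff ⟨0, Submodule.zero_mem _⟩).1 h
  have h0 : φ w = 0 := congrFun (LinearMap.mem_ker.1 hw) ⟨φ, hφ⟩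
  calc |φ x| = ‖φ (x - w)‖ := by rw [map_sub, h0, sub_zero, Real.norm_eq_abs]
    _ ≤ ‖φ‖ * ‖x - w‖ := φ.le_opNorm _
    _ ≤ ‖φ‖ * tol := by
      rw [← dist_eq_norm]; exact mul_le_mul_of_nonneg_left hxw.le (norm_nonneg _)

theorem abs_le_of_infDist_ofFinite_G {tol : ℝ} (htol : 0 < tol) {Φ : Finset (StrongDual ℝ X)}
    {V : Finset X} {f : StrongDual ℝ X}
    (h : Metric.infDist f (SpaceMove.ofFinite tol htol Φ V).G < tol)
    {v : X} (hv : v ∈ V) : |f v| ≤ tol * ‖v‖ := by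
  obtain ⟨g, hg, hfg⟩ := (Metric.infDist_lt_iff ⟨0, Submodule.zero_mem _⟩).1 h
  have h0 : g v = 0 := congrFun (LinearMap.mem_ker.1 hg) ⟨v, hv⟩
  calc |f v| = ‖(f - g) v‖ := by
        rw [_root_.sub_apply, h0, sub_zero, Real.norm_eq_abs]
    _ ≤ ‖f - g‖ * ‖v‖ := (f - g).le_opNorm _
    _ ≤ tol * ‖v‖ := by
      rw [← dist_eq_norm]; exact mul_le_mul_of_nonneg_right hfg.le (norm_nonneg _)

/-- Player I can choose signs so that the diagonal entry of an operator stays large, provided that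
the diagonal entries have constant sign on both parts of the partition. -/
theorem Response.exists_signs {e : SchauderBasis ℝ X} {S : X →L[ℝ] X} {δ η : ℝ} (hδ : 0 ≤ δ)
    (hS : ∀ j, δ ≤ |e.coord j (S (e j))|) {r : Response}
    (hr : r.Legal {i | 0 ≤ e.coord i (S (e i))} η) :
    ∃ ε : ℕ → ℤˣ, (1 - η) * δ ≤ |r.functional e ε (S (r.vec e ε))| := by
  obtain ⟨hE, hpos, hlow, -⟩ := hr
  obtain ⟨s, hs, hsE⟩ : ∃ s : ℝ, |s| = 1 ∧ ∀ i ∈ r.E, δ ≤ s * e.coord i (S (e i)) := by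
    rcases hE with hE | hE
    · refine ⟨1, by simp, fun i hi => ?_⟩
      have h0 : 0 ≤ e.coord i (S (e i)) := hE hi
      simpa [abs_of_nonneg h0] using hS i
    · refine ⟨-1, by simp, fun i hi => ?_⟩
      have h0 : ¬ 0 ≤ e.coord i (S (e i)) := hE hi
      simpa [abs_of_neg (not_le.1 h0)] using hS i
  obtain ⟨ε, hε⟩ := exists_signs_trace_le r.E
    fun i j => s * (r.mu i * r.lam j * e.coord i (S (e j)))
  refine ⟨ε, ?_⟩
  have h1 : ∑ i ∈ r.E, ∑ j ∈ r.E, (((ε i : ℤ) : ℝ) * ((ε j : ℤ) : ℝ)) *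
      (s * (r.mu i * r.lam j * e.coord i (S (e j)))) =
      s * r.functional e ε (S (r.vec e ε)) := by
    simp only [Response.functional, Response.vec, map_sum, map_smul, _root_.sum_apply,
      _root_.smul_apply, smul_eq_mul, Finset.mul_sum]
    refine (Finset.sum_comm).trans (Finset.sum_congr rfl fun i _ => Finset.sum_congr rfl
      fun j _ => ?_)
    ring
  have h2 : (1 - η) * δ ≤ ∑ i ∈ r.E, s * (r.mu i * r.lam i * e.coord i (S (e i))) := by
    calc (1 - η) * δ ≤ (∑ i ∈ r.E, r.lam i * r.mu i) * δ :=
          mul_le_mul_of_nonneg_right hlow.le hδ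
      _ = ∑ i ∈ r.E, r.lam i * r.mu i * δ := Finset.sum_mul _ _ _
      _ ≤ ∑ i ∈ r.E, s * (r.mu i * r.lam i * e.coord i (S (e i))) := by
        refine Finset.sum_le_sum fun i hi => ?_
        have := mul_le_mul_of_nonneg_left (hsE i hi)
          (mul_nonneg (hpos i hi).1 (hpos i hi).2)
        linarith
  rw [h1] at hε
  calc (1 - η) * δ ≤ s * r.functional e ε (S (r.vec e ε)) := h2.trans hε
    _ ≤ |s * r.functional e ε (S (r.vec e ε))| := le_abs_self _
    _ = _ := by rw [abs_mul, hs, one_mul]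

end Moves

section Game

variable {X : ℕ → Type*} [∀ k, NormedAddCommGroup (X k)] [∀ k, NormedSpace ℝ (X k)]

/-- The component `X l → X k` of an operator on the `ℓ^∞`-sum. -/
noncomputable def block (T : lp X ∞ →L[ℝ] lp X ∞) (k l : ℕ) : X l →L[ℝ] X k :=
  (lp.evalCLM ℝ X ∞ k).comp (T.comp (lp.singleContinuousLinearMap ℝ X ∞ l))

theorem block_apply (T : lp X ∞ →L[ℝ] lp X ∞) (k l : ℕ) (v : X l) :
    block T k l v = (T (lp.single ∞ l v) : ∀ i, X i) k := rfl

theorem norm_block_le (T : lp X ∞ →L[ℝ] lp X ∞) (k l : ℕ) : ‖block T k l‖ ≤ ‖T‖ := by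
  refine ContinuousLinearMap.opNorm_le_bound _ (norm_nonneg _) fun v => ?_
  rw [block_apply]
  refine (lp.norm_apply_le_norm ENNReal.top_ne_zero _ k).trans ((T.le_opNorm _).trans ?_)
  rw [lp.norm_single (by simp)]

/-- Playing all the games at once, Player I forces Player II to produce systems on which `T` is
almost diagonal, with large diagonal. -/
theorem exists_almost_diagonal_systems (e : ∀ k, SchauderBasis ℝ (X k)) (he : ∀ k j, ‖e k j‖ = 1)
    {C lam : ℝ} (hC : 1 ≤ C) (hlam : 1 ≤ lam)
    (hproj : ∀ k n, ‖SchauderBasis.proj (e k) n‖ ≤ lam)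
    (hrep : SimultaneouslyStrategicallyReproducible e C) (T : lp X ∞ →L[ℝ] lp X ∞)
    {δ : ℝ} (hδ : 0 < δ) (hT : ∀ k j, δ ≤ |(e k).coord j (block T k k (e k j))|)
    {η θ : ℝ} (hη : 0 < η) (hθ : 0 < θ) :
    ∃ (x : ∀ k, ℕ → X k) (f : ∀ k, ℕ → StrongDual ℝ (X k)),
      (∀ k (s : Finset ℕ) (a : ℕ → ℝ),
        ‖∑ i ∈ s, a i • x k i‖ ≤ √(C + η) * ‖∑ i ∈ s, a i • e k i‖) ∧
      (∀ k (s : Finset ℕ) (a : ℕ → ℝ),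
        ‖∑ i ∈ s, a i • f k i‖ ≤ √(C + η) * ‖∑ i ∈ s, a i • (e k).coord i‖) ∧
      (∀ k j, (1 - η) * δ ≤ |f k j (block T k k (x k j))|) ∧
      (∀ k j l i, (k, j) ≠ (l, i) → |f k j (block T k l (x l i))| ≤ θ * (1 / 2) ^ (j + l + i)) ∧
      (∀ k i j, i < j → |f k j (e k i)| ≤ (1 / 2) ^ j) := by
  classical
  choose σ hσ using fun k => hrep k η hη
  let N : ℕ → Set ℕ := fun k => {i | 0 ≤ (e k).coord i (block T k k (e k i))}
  -- `M` dominates the norms of `f k j ∘ block T k l` and of `block T k l (x l i)`.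
  set M : ℝ := √(C + η) * (2 * lam) * ‖T‖ + 1 with hM
  have hMpos : 0 < M := by positivity
  -- With `t` the later of two positions, `j`, `l` and `i` are all at most `t`; `1 / 8 = (1 / 2) ^
  -- 3` therefore pays for `(1 / 2) ^ (j + l + i)`. The cap `1` serves the estimate of `f k j (e k
  -- i)`.
  let tol : ℕ → ℝ := fun t => min (θ / M) 1 * (1 / 8) ^ t
  have htol : ∀ t, 0 < tol t := fun t => by positivity
  let D : ℕ × ℕ → Type _ := fun s =>
    SpaceMove (X s.1) × (ℕ → ℤˣ) × X s.1 × StrongDual ℝ (X s.1)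
  have hD : ∀ s, Nonempty (D s) := fun s =>
    ⟨SpaceMove.ofFinite 1 one_pos ∅ ∅, 1, 0, 0⟩
  let m : ℕ × ℕ → ℕ := fun s => Nat.pair s.1 s.2
  -- The new vector should nearly vanish under the earlier functionals composed with `T`; the new
  -- functional should be small on the `T`-images of earlier vectors and on `e i` for `i < s.2`.
  let move : (s : ℕ × ℕ) → (∀ s, D s) → SpaceMove (X s.1) := fun s h =>
    SpaceMove.ofFinite (tol (m s)) (htol _)
      ((Finset.range (m s)).image fun n =>
        (h n.unpair).2.2.2.comp (block T n.unpair.1 s.1))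
      (((Finset.range (m s)).image fun n => block T s.1 n.unpair.1 (h n.unpair).2.2.1) ∪
        (Finset.range s.2).image (e s.1))
  -- The history covers only earlier turns, so the current move `p` is inserted at position `s.2`.
  let resp : (s : ℕ × ℕ) → (∀ s, D s) → SpaceMove (X s.1) → Response := fun s h p =>
    σ s.1 (N s.1) s.2 (fun i => if (i : ℕ) < s.2 then (h (s.1, i)).1 else p)
      fun i => (h (s.1, i)).2.1
  -- Winning asserts legality only for complete plays, available after the recursion; as a premise
  -- here, it lets every history be continued.
  let R : ∀ s, (∀ s, D s) → D s → Prop := fun s h d =>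
    d.1 = move s h ∧ d.2.2.1 = (resp s h d.1).vec (e s.1) d.2.1 ∧
      d.2.2.2 = (resp s h d.1).functional (e s.1) d.2.1 ∧
      ((resp s h d.1).Legal (N s.1) η → (1 - η) * δ ≤ |d.2.2.2 (block T s.1 s.1 d.2.2.1)|)
  have hR : ∀ s h, ∃ d, R s h d := by
    intro s h
    by_cases hl : (resp s h (move s h)).Legal (N s.1) η
    · obtain ⟨ε, hε⟩ := Response.exists_signs hδ.le (hT s.1) hl
      exact ⟨⟨move s h, ε, _, _⟩, rfl, rfl, rfl, fun _ => hε⟩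
    · exact ⟨⟨move s h, 1, (resp s h (move s h)).vec (e s.1) 1,
        (resp s h (move s h)).functional (e s.1) 1⟩, rfl, rfl, rfl, fun h' => absurd h' hl⟩
  obtain ⟨d, hd⟩ := exists_recursive m R hR
  choose h hh hRd using hd
  let p : ∀ k, ℕ → SpaceMove (X k) := fun k j => (d (k, j)).1
  let ε : ℕ → ℕ → ℕ → ℤˣ := fun k j => (d (k, j)).2.1
  let x : ∀ k, ℕ → X k := fun k j => (d (k, j)).2.2.1
  let f : ∀ k, ℕ → StrongDual ℝ (X k) := fun k j => (d (k, j)).2.2.2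
  have hlt : ∀ k i j, i < j → m (k, i) < m (k, j) := fun k i j hij => Nat.pair_lt_pair_right k hij
  -- Earlier turns of game `k` have smaller `m`, so the recursive responses are those of one genuine
  -- play against `σ k`.
  have hresp : ∀ k j, resp (k, j) (h (k, j)) (p k j) = (σ k).response (N k) (p k) (ε k) j := by
    intro k j
    have h1 : (fun i : Fin (j + 1) => if (i : ℕ) < j then (h (k, j) (k, i)).1 else p k j) =
        fun i : Fin (j + 1) => p k i := by
      funext i
      split_ifs with hi
      · rw [hh (k, j) (k, i) (hlt k i j hi)]
      · have : (i : ℕ) = j := by omega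
        rw [this]
    have h2 : (fun i : Fin j => (h (k, j) (k, i)).2.1) = fun i : Fin j => ε k i := by
      funext i
      rw [hh (k, j) (k, i) (hlt k i j i.2)]
    change σ k (N k) j _ _ = σ k (N k) j _ _
    rw [← h1, ← h2]
  have hx : ∀ k j, x k j = ((σ k).response (N k) (p k) (ε k) j).vec (e k) (ε k j) :=
    fun k j => by rw [← hresp]; exact (hRd (k, j)).2.1
  have hf : ∀ k j, f k j = ((σ k).response (N k) (p k) (ε k) j).functional (e k) (ε k j) :=
    fun k j => by rw [← hresp]; exact (hRd (k, j)).2.2.1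
  have hwin := fun k => hσ k (N k) (p k) (ε k)
  have hxe : ∀ k (s : Finset ℕ) (a : ℕ → ℝ),
      ‖∑ i ∈ s, a i • x k i‖ ≤ √(C + η) * ‖∑ i ∈ s, a i • e k i‖ := fun k s a => by
    simp only [hx]; exact ((hwin k).2.1 s a).2
  have hfe : ∀ k (s : Finset ℕ) (a : ℕ → ℝ),
      ‖∑ i ∈ s, a i • f k i‖ ≤ √(C + η) * ‖∑ i ∈ s, a i • (e k).coord i‖ := fun k s a => by
    simp only [hf]; exact ((hwin k).2.2.1 s a).2
  have hxn : ∀ k j, ‖x k j‖ ≤ √(C + η) * (2 * lam) := fun k j => by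
    have := hxe k {j} 1
    simp only [Finset.sum_singleton, Pi.one_apply, one_smul, he, mul_one] at this
    exact this.trans (le_mul_of_one_le_right (Real.sqrt_nonneg _) (by linarith))
  have hfn : ∀ k j, ‖f k j‖ ≤ √(C + η) * (2 * lam) := fun k j => by
    have := hfe k {j} 1
    simp only [Finset.sum_singleton, Pi.one_apply, one_smul] at this
    exact this.trans (mul_le_mul_of_nonneg_left (norm_coord_le (he k) (hproj k) j)
      (Real.sqrt_nonneg _))
  have hdist : ∀ k j, Metric.infDist (x k j) (move (k, j) (h (k, j))).W < tol (m (k, j)) ∧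
      Metric.infDist (f k j) (move (k, j) (h (k, j))).G < tol (m (k, j)) := fun k j => by
    have h1 := (hwin k).2.2.2.1 j
    have h2 := (hwin k).2.2.2.2 j
    rw [← hx] at h1
    rw [← hf] at h2
    have hp : p k j = move (k, j) (h (k, j)) := (hRd (k, j)).1
    rw [hp] at h1 h2
    exact ⟨h1, h2⟩
  -- If the vector comes later, its distance to `W` gives the bound; if the functional comes later
  -- (`hlower`), its distance to `G` does.
  have hupper : ∀ k j l i, m (k, j) < m (l, i) →
      |f k j (block T k l (x l i))| ≤ M * tol (m (l, i)) := by
    intro k j l i hlt'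
    have hmem : (f k j).comp (block T k l) ∈ (Finset.range (m (l, i))).image fun n =>
        (h (l, i) n.unpair).2.2.2.comp (block T n.unpair.1 l) := by
      refine Finset.mem_image.2 ⟨m (k, j), Finset.mem_range.2 hlt', ?_⟩
      have hun : (m (k, j)).unpair = (k, j) := Nat.unpair_pair k j
      rw [hun, hh (l, i) (k, j) hlt']
    refine (abs_le_of_infDist_ofFinite_W (htol _) (hdist l i).1 hmem).trans
      (mul_le_mul_of_nonneg_right ?_ (htol _).le)
    refine (ContinuousLinearMap.opNorm_comp_le _ _).trans ?_
    have := mul_le_mul (hfn k j) (norm_block_le T k l) (norm_nonneg _) (by positivity)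
    linarith
  have hlower : ∀ k j l i, m (l, i) < m (k, j) →
      |f k j (block T k l (x l i))| ≤ M * tol (m (k, j)) := by
    intro k j l i hlt'
    have hmem : block T k l (x l i) ∈ (((Finset.range (m (k, j))).image fun n =>
        block T k n.unpair.1 (h (k, j) n.unpair).2.2.1) ∪ (Finset.range j).image (e k)) := by
      refine Finset.mem_union_left _ (Finset.mem_image.2 ⟨m (l, i), Finset.mem_range.2 hlt', ?_⟩)
      have hun : (m (l, i)).unpair = (l, i) := Nat.unpair_pair l i
      rw [hun, hh (k, j) (l, i) hlt']
    refine (abs_le_of_infDist_ofFinite_G (htol _) (hdist k j).2 hmem).trans ?_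
    rw [mul_comm]
    refine mul_le_mul_of_nonneg_right ?_ (htol _).le
    have := mul_le_mul (norm_block_le T k l) (hxn l i) (norm_nonneg _) (by positivity)
    linarith [(block T k l).le_opNorm (x l i)]
  have htolle : ∀ t n, n ≤ 3 * t → M * tol t ≤ θ * (1 / 2) ^ n := by
    intro t n hn
    have h1 : M * min (θ / M) 1 ≤ θ :=
      (mul_le_mul_of_nonneg_left (min_le_left _ _) hMpos.le).trans_eq (mul_div_cancel₀ _ hMpos.ne')
    have h2 : ((1 : ℝ) / 8) ^ t ≤ (1 / 2) ^ n := by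
      rw [show (1 : ℝ) / 8 = (1 / 2) ^ 3 by norm_num, ← pow_mul]
      exact pow_le_pow_of_le_one (by norm_num) (by norm_num) hn
    calc M * tol t = M * min (θ / M) 1 * (1 / 8) ^ t := by simp only [tol]; ring
      _ ≤ θ * (1 / 2) ^ n := mul_le_mul h1 h2 (by positivity) hθ.le
  have hml : ∀ k j, k ≤ m (k, j) ∧ j ≤ m (k, j) := fun k j =>
    ⟨Nat.left_le_pair k j, Nat.right_le_pair k j⟩
  refine ⟨x, f, hxe, hfe, fun k j => ?_, fun k j l i hne => ?_, fun k i j hij => ?_⟩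
  · refine (hRd (k, j)).2.2.2 ?_
    have := (hwin k).1 j
    rwa [← hresp] at this
  · have hmne : m (k, j) ≠ m (l, i) := fun heq => hne (by
      obtain ⟨h1, h2⟩ := Nat.pair_eq_pair.1 heq
      exact Prod.ext h1 h2)
    rcases lt_or_gt_of_ne hmne with hlt' | hlt'
    · exact (hupper k j l i hlt').trans (htolle _ _ (by
        have := hml k j; have := hml l i; omega))
    · exact (hlower k j l i hlt').trans (htolle _ _ (by
        have := hml k j; have := hml l i; omega))
  · have hmem : e k i ∈ (((Finset.range (m (k, j))).image fun n =>
        block T k n.unpair.1 (h (k, j) n.unpair).2.2.1) ∪ (Finset.range j).image (e k)) :=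
      Finset.mem_union_right _ (Finset.mem_image_of_mem _ (Finset.mem_range.2 hij))
    refine (abs_le_of_infDist_ofFinite_G (htol _) (hdist k j).2 hmem).trans ?_
    rw [he, mul_one]
    calc tol (m (k, j)) ≤ 1 * (1 / 2) ^ m (k, j) :=
          mul_le_mul (min_le_right _ _)
            (pow_le_pow_left₀ (by norm_num) (by norm_num) _) (by positivity) zero_le_one
      _ ≤ (1 / 2) ^ j := by
        rw [one_mul]
        exact pow_le_pow_of_le_one (by norm_num) (by norm_num) (hml k j).2

end Game

/-! ### Diagonal operators and perturbations of the identity. -/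

section Diagonal

variable {X : Type*} [NormedAddCommGroup X] [NormedSpace ℝ X]

theorem norm_sum_smul_le_of_geometric {e : ℕ → X} (he : ∀ j, ‖e j‖ = 1) {r : ℕ → ℝ} {w : ℝ}
    (hw : 0 ≤ w) (hr : ∀ j, |r j| ≤ w * (1 / 2) ^ j) (s : Finset ℕ) :
    ‖∑ j ∈ s, r j • e j‖ ≤ w * 2 := by
  refine (norm_sum_le _ _).trans ?_
  calc ∑ j ∈ s, ‖r j • e j‖ ≤ ∑ j ∈ s, w * (1 / 2) ^ j := by
        refine Finset.sum_le_sum fun j _ => ?_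
        rw [norm_smul, he, mul_one, Real.norm_eq_abs]
        exact hr j
    _ ≤ w * 2 := sum_le_hasSum s (fun j _ => by positivity) (hasSum_geometric_two.mul_left w)

/-- The value of a functional on a vector synthesised from a sequence on which the functional is
small, except possibly at one place. -/
theorem abs_apply_synthesis_sub_le {e : SchauderBasis ℝ X} {lam : ℝ} (hlam : 0 ≤ lam)
    (hcoord : ∀ j, ‖e.coord j‖ ≤ 2 * lam) {Y : Type*} [NormedAddCommGroup Y] [NormedSpace ℝ Y]
    {x : ℕ → Y} {v : X} {y : Y}
    (hy : Tendsto (fun n => ∑ j ∈ Finset.range n, e.coord j v • x j) atTop (𝓝 y))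
    (g : StrongDual ℝ Y) (j : ℕ) (t : ℝ) {w : ℝ} (hw : 0 ≤ w)
    (hg : ∀ i, |g (x i) - if i = j then t else 0| ≤ w * (1 / 2) ^ i) :
    |g y - t * e.coord j v| ≤ 4 * lam * w * ‖v‖ := by
  have hlim : Tendsto (fun n => |∑ i ∈ Finset.range n, e.coord i v * g (x i) - t * e.coord j v|)
      atTop (𝓝 |g y - t * e.coord j v|) := by
    have := ((g.continuous.tendsto y).comp hy).sub_const (t * e.coord j v)
    simpa [Function.comp_def] using this.abs
  refine le_of_tendsto hlim ?_
  filter_upwards [eventually_gt_atTop j] with n hn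
  have h1 : ∑ i ∈ Finset.range n, e.coord i v * g (x i) - t * e.coord j v =
      ∑ i ∈ Finset.range n, e.coord i v * (g (x i) - if i = j then t else 0) := by
    simp only [mul_sub, Finset.sum_sub_distrib, mul_ite, mul_zero, Finset.sum_ite_eq',
      Finset.mem_range, hn, if_true]
    ring
  rw [h1]
  refine (Finset.abs_sum_le_sum_abs _ _).trans ?_
  calc ∑ i ∈ Finset.range n, |e.coord i v * (g (x i) - if i = j then t else 0)|
      ≤ ∑ i ∈ Finset.range n, 2 * lam * ‖v‖ * w * (1 / 2) ^ i := by
        refine Finset.sum_le_sum fun i _ => ?_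
        rw [abs_mul, mul_assoc (2 * lam * ‖v‖)]
        exact mul_le_mul (ContinuousLinearMap.le_of_opNorm_le _ (hcoord i) v) (hg i)
          (abs_nonneg _) (by positivity)
    _ ≤ 2 * lam * ‖v‖ * w * 2 :=
      sum_le_hasSum _ (fun i _ => by positivity) (hasSum_geometric_two.mul_left _)
    _ = 4 * lam * w * ‖v‖ := by ring

theorem coord_diagonal_operator {e : SchauderBasis ℝ X} {d : ℕ → ℝ} {D : X →L[ℝ] X}
    (hD : ∀ v,
      Tendsto (fun n => ∑ j ∈ Finset.range n, (d j * e.coord j v) • e j) atTop (𝓝 (D v)))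
    (m j : ℕ) : e.coord m (D (e j)) = if m = j then d j else 0 := by
  have h1 : D (e j) = d j • e j := by
    refine tendsto_nhds_unique (hD (e j)) (tendsto_const_nhds.congr' ?_)
    filter_upwards [eventually_gt_atTop j] with n hn
    simp [coord_apply_basis, hn]
  rw [h1, map_smul, coord_apply_basis, smul_eq_mul, mul_ite, mul_one, mul_zero]

/-- Applying the property to `a⁻¹ • D` keeps the constant `K δ` instead of `K (a * δ)`, as nothing
is known about how `K` varies. The norm of `B` is moved into `A`, which gives separate bounds usable
uniformly over all coordinates. -/
theorem DiagonalFactorizationProperty.exists_normalized {e : SchauderBasis ℝ X}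
    (he : ∀ j, ‖e j‖ = 1) {K : ℝ → ℝ} (hK : DiagonalFactorizationProperty e K) {δ a η : ℝ}
    (hδ : 0 < δ) (ha : 0 < a) (hη : 0 < η) {D : X →L[ℝ] X} (hD : IsDiagonal e D)
    (hDδ : ∀ j, a * δ ≤ |e.coord j (D (e j))|) :
    ∃ A B : X →L[ℝ] X, ‖A‖ ≤ (K δ + η) / a ∧ ‖B‖ ≤ 1 ∧ ∀ v, A (D (B v)) = v := by
  obtain ⟨A, B, hAB, hid⟩ := hK δ hδ (a⁻¹ • D)
    (fun m j hmj => by simp [hD m j hmj]) (fun j => by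
      rw [_root_.smul_apply, map_smul, smul_eq_mul, abs_mul, abs_of_pos (inv_pos.2 ha),
        le_inv_mul_iff₀ ha]
      exact hDδ j) η hη
  have hid' : ∀ v, a⁻¹ • A (D (B v)) = v := fun v => by
    have := DFunLike.congr_fun hid v
    simpa using this
  have hB : 0 < ‖B‖ := by
    rw [norm_pos_iff]
    rintro rfl
    have h0 := hid' (e 0)
    have h1 := he 0
    rw [← h0] at h1
    simp at h1
  refine ⟨(a⁻¹ * ‖B‖) • A, ‖B‖⁻¹ • B, ?_, ?_, fun v => ?_⟩
  · rw [norm_smul, Real.norm_eq_abs, abs_of_pos (by positivity), div_eq_inv_mul, mul_assoc,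
      mul_comm ‖B‖]
    exact mul_le_mul_of_nonneg_left hAB (inv_pos.2 ha).le
  · rw [norm_smul, norm_inv, norm_norm, inv_mul_cancel₀ hB.ne']
  · have : ‖B‖⁻¹ * (a⁻¹ * ‖B‖) = a⁻¹ := by field_simp
    simp only [_root_.smul_apply, map_smul, smul_smul]
    rw [this, hid']

variable [CompleteSpace X]

/-- If a series of functionals along the basis converges, then so does its diagonal part, provided
that the functionals are close to multiples of the coordinate functionals. -/
theorem exists_diagonal_operator {e : SchauderBasis ℝ X} (he : ∀ j, ‖e j‖ = 1)
    (h : ℕ → StrongDual ℝ X) {c : ℝ} (hc : 0 ≤ c)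
    (hbound : ∀ n v, ‖∑ j ∈ Finset.range n, h j v • e j‖ ≤ c * ‖v‖)
    (hconv : ∀ v, CauchySeq fun n => ∑ j ∈ Finset.range n, h j v • e j)
    (d : ℕ → ℝ) {w : ℝ} (hw : 0 ≤ w)
    (hd : ∀ j v, |h j v - d j * e.coord j v| ≤ w * ‖v‖ * (1 / 2) ^ j) :
    ∃ D : X →L[ℝ] X, ∀ v,
      Tendsto (fun n => ∑ j ∈ Finset.range n, (d j * e.coord j v) • e j) atTop (𝓝 (D v)) := by
  -- The diagonal series is a convergent series minus an absolutely convergent error.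
  have hsplit : ∀ n v, ∑ j ∈ Finset.range n, (d j * e.coord j v) • e j =
      (∑ j ∈ Finset.range n, h j v • e j) -
        ∑ j ∈ Finset.range n, (h j v - d j * e.coord j v) • e j := fun n v => by
    rw [← Finset.sum_sub_distrib]
    exact Finset.sum_congr rfl fun j _ => by rw [← sub_smul, sub_sub_cancel]
  have hg : ∀ n v, (∑ j ∈ Finset.range n, (d j • e.coord j).smulRight (e j)) v =
      ∑ j ∈ Finset.range n, (d j * e.coord j v) • e j := fun n v => by simp
  obtain ⟨D, -, hD⟩ := exists_limit_operator
    (fun n => ∑ j ∈ Finset.range n, (d j • e.coord j).smulRight (e j)) (c := c + w * 2)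
    (by positivity) (fun n v => by
      rw [hg, hsplit]
      refine (norm_sub_le _ _).trans ?_
      have := norm_sum_smul_le_of_geometric he (by positivity) (hd · v) (Finset.range n)
      linarith [hbound n v]) (fun v => by
      simp only [hg, hsplit]
      have hs : Summable fun j => (h j v - d j * e.coord j v) • e j := by
        refine Summable.of_norm_bounded (g := fun j => w * ‖v‖ * (1 / 2) ^ j)
          (summable_geometric_two.mul_left _) fun j => ?_
        rw [norm_smul, he, mul_one, Real.norm_eq_abs]
        exact hd j v
      obtain ⟨y, hy⟩ := cauchySeq_tendsto_of_complete (hconv v)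
      exact (hy.sub hs.hasSum.tendsto_sum_nat).cauchySeq)
  exact ⟨D, fun v => by simpa only [hg] using hD v⟩

end Diagonal

/-- An operator through which a small perturbation of the identity factors is a factor of the
identity. -/
theorem idFactorsThrough_of_perturbation {V U : Type*} [NormedAddCommGroup V] [NormedSpace ℝ V]
    [CompleteSpace V] [NormedAddCommGroup U] [NormedSpace ℝ U] (T : U →L[ℝ] U) (A : U →L[ℝ] V)
    (B : V →L[ℝ] U) {q c : ℝ} (hq0 : 0 ≤ q) (hq : q < 1) (h : ∀ v, ‖A (T (B v)) - v‖ ≤ q * ‖v‖)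
    (hc : ‖A‖ * ‖B‖ / (1 - q) ≤ c) : IdFactorsThrough V c T := by
  have ht : ‖ContinuousLinearMap.id ℝ V - A.comp (T.comp B)‖ ≤ q := by
    refine ContinuousLinearMap.opNorm_le_bound _ hq0 fun v => ?_
    rw [_root_.sub_apply, norm_sub_rev]
    exact h v
  let u : (V →L[ℝ] V)ˣ := Units.oneSub _ (ht.trans_lt hq)
  have hu : (u : V →L[ℝ] V) = A.comp (T.comp B) := by
    change 1 - (ContinuousLinearMap.id ℝ V - A.comp (T.comp B)) = _
    exact sub_sub_cancel _ _
  have h1q : 0 < 1 - q := by linarith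
  have hun : ‖(↑u⁻¹ : V →L[ℝ] V)‖ ≤ (1 - q)⁻¹ := by
    refine ContinuousLinearMap.opNorm_le_bound _ (inv_pos.2 h1q).le fun w => ?_
    set y := (↑u⁻¹ : V →L[ℝ] V) w with hy
    have hw : A (T (B y)) = w := by
      have := DFunLike.congr_fun (u.mul_inv) w
      rw [hu] at this
      exact this
    have h2 := h y
    rw [hw] at h2
    have h3 : ‖y‖ ≤ ‖w‖ + ‖w - y‖ := by
      have := norm_sub_le w (w - y)
      rwa [sub_sub_cancel] at this
    rw [inv_mul_eq_div, le_div_iff₀ h1q]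
    linarith
  refine ⟨(↑u⁻¹ : V →L[ℝ] V).comp A, B, ?_, ?_⟩
  · calc ‖(↑u⁻¹ : V →L[ℝ] V).comp A‖ * ‖B‖ ≤ (1 - q)⁻¹ * ‖A‖ * ‖B‖ := by
          refine mul_le_mul_of_nonneg_right ?_ (norm_nonneg _)
          exact (ContinuousLinearMap.opNorm_comp_le _ _).trans
            (mul_le_mul_of_nonneg_right hun (norm_nonneg _))
      _ = ‖A‖ * ‖B‖ / (1 - q) := by rw [div_eq_inv_mul, mul_assoc]
      _ ≤ c := hc
  · have h4 := u.inv_mul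
    rw [hu] at h4
    exact h4

/-! ### Assembling the factorization over `Γ`. -/

section Factorization

variable {X : ℕ → Type*} [∀ k, NormedAddCommGroup (X k)] [∀ k, NormedSpace ℝ (X k)]

theorem norm_evalCLM_le {ι : Type*} (Y : ι → Type*) [∀ i, NormedAddCommGroup (Y i)]
    [∀ i, NormedSpace ℝ (Y i)] (i : ι) : ‖lp.evalCLM ℝ Y ∞ i‖ ≤ 1 :=
  ContinuousLinearMap.opNorm_le_bound _ zero_le_one fun z => by
    rw [one_mul]; exact lp.norm_apply_le_norm ENNReal.top_ne_zero z i

variable [∀ k, CompleteSpace (X k)]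

/-- The coordinates `B k ∘ B' k` and `A' k ∘ A k` assemble to operators of norm at most `c` and `K₁
* (c * lam)`. Around `T` they give the identity up to an error `η`, and correcting this costs one
more factor `1 / (1 - η)`. -/
theorem idFactorsThrough_of_almost_diagonal (e : ∀ k, SchauderBasis ℝ (X k))
    (he : ∀ k j, ‖e k j‖ = 1) {lam : ℝ} (hlam : 1 ≤ lam)
    (hproj : ∀ k n, ‖SchauderBasis.proj (e k) n‖ ≤ lam) {K : ℝ → ℝ}
    (hdiag : ∀ k, DiagonalFactorizationProperty (e k) K) (T : lp X ∞ →L[ℝ] lp X ∞)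
    {δ η θ c : ℝ} (hδ : 0 < δ) (hKδ : 0 < K δ) (hη : 0 < η) (hη1 : η < 1) (hθ : 0 < θ)
    (hc : 0 ≤ c) (hθη : (K δ + η) / (1 - η) * (16 * lam * θ) ≤ η)
    (x : ∀ k, ℕ → X k) (f : ∀ k, ℕ → StrongDual ℝ (X k))
    (hx : ∀ k (s : Finset ℕ) (a : ℕ → ℝ), ‖∑ i ∈ s, a i • x k i‖ ≤ c * ‖∑ i ∈ s, a i • e k i‖)
    (hf : ∀ k (s : Finset ℕ) (a : ℕ → ℝ),
      ‖∑ i ∈ s, a i • f k i‖ ≤ c * ‖∑ i ∈ s, a i • (e k).coord i‖)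
    (hlarge : ∀ k j, (1 - η) * δ ≤ |f k j (block T k k (x k j))|)
    (hsmall : ∀ k j l i, (k, j) ≠ (l, i) →
      |f k j (block T k l (x l i))| ≤ θ * (1 / 2) ^ (j + l + i))
    (hbasis : ∀ k i j, i < j → |f k j (e k i)| ≤ (1 / 2) ^ j)
    (Γ : Set ℕ) (hΓ : ∀ k j, RegularOn ((f k j).comp ((lp.evalCLM ℝ X ∞ k).comp T)) Γ) :
    IdFactorsThrough (EllInfty X Γ) (lam * c ^ 2 * (K δ + η) / (1 - η) ^ 2) T := by
  classical
  have hlam0 : 0 ≤ lam := by linarith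
  have h1η : 0 < 1 - η := by linarith
  have hcoord := fun k => norm_coord_le (he k) (hproj k)
  choose B hBn hB using fun k => exists_synthesis (e k) (hproj k) (x k) hc (hx k)
  -- The bound on `f k j (e k i)` holds only for `j > i`, hence the shift by `i + 1`.
  choose A hAn hA using fun k => exists_analysis (e k) (hproj k) (he k) (f k) hc (hf k) fun i =>
    (summable_nat_add_iff (i + 1)).1 (Summable.of_nonneg_of_le (fun _ => abs_nonneg _)
      (fun j => hbasis k i (j + (i + 1)) (by omega))
      ((summable_nat_add_iff (i + 1)).2 summable_geometric_two))
  let d : ∀ _ : ℕ, ℕ → ℝ := fun k j => f k j (block T k k (x k j))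
  have hdiagEst : ∀ k j (v : X k), |f k j (block T k k (B k v)) - d k j * (e k).coord j v| ≤
      4 * lam * (θ * (1 / 2) ^ (j + k)) * ‖v‖ := fun k j v => by
    refine abs_apply_synthesis_sub_le hlam0 (hcoord k) (hB k v) ((f k j).comp (block T k k)) j _
      (by positivity) fun i => ?_
    split_ifs with hij
    · subst hij
      simp only [d, ContinuousLinearMap.comp_apply, sub_self, abs_zero]
      positivity
    · rw [sub_zero, mul_assoc, ← pow_add]
      exact hsmall k j k i fun h => hij (congrArg Prod.snd h).symm
  have hoffEst : ∀ k j l, l ≠ k → ∀ v : X l, |f k j (block T k l (B l v))| ≤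
      4 * lam * (θ * (1 / 2) ^ (j + l)) * ‖v‖ := fun k j l hlk v => by
    -- Here no place is exceptional, so the value `t` is `0` and its index is irrelevant.
    have := abs_apply_synthesis_sub_le hlam0 (hcoord l) (hB l v) ((f k j).comp (block T k l)) 0 0
      (w := θ * (1 / 2) ^ (j + l)) (by positivity) fun i => by
        rw [ite_self, sub_zero, mul_assoc, ← pow_add]
        exact hsmall k j l i fun h => hlk (congrArg Prod.fst h).symm
    simpa using this
  have hD : ∀ k, ∃ D : X k →L[ℝ] X k, ∀ v, Tendsto
      (fun n => ∑ j ∈ Finset.range n, (d k j * (e k).coord j v) • e k j) atTop (𝓝 (D v)) := by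
    intro k
    refine exists_diagonal_operator (he k) (fun j => (f k j).comp ((block T k k).comp (B k)))
      (c := c * lam * (‖T‖ * c)) (by positivity) (fun n v => ?_)
      (fun v => (hA k (block T k k (B k v))).cauchySeq) (d k) (w := 4 * lam * θ)
      (by positivity) fun j v => ?_
    · refine (norm_sum_functional_smul_le (e k) (hproj k) (f k) hc (hf k) n
        (block T k k (B k v))).trans ?_
      rw [mul_assoc (c * lam)]
      refine mul_le_mul_of_nonneg_left ?_ (by positivity)
      rw [mul_assoc]
      exact ((block T k k).le_of_opNorm_le (norm_block_le T k k) _).trans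
        (mul_le_mul_of_nonneg_left ((B k).le_of_opNorm_le (hBn k) v) (norm_nonneg _))
    · refine (hdiagEst k j v).trans ?_
      have h1 : ((1 : ℝ) / 2) ^ (j + k) ≤ (1 / 2) ^ j :=
        pow_le_pow_of_le_one (by norm_num) (by norm_num) (by omega)
      have h2 := mul_le_mul_of_nonneg_left h1 (show 0 ≤ 4 * lam * θ * ‖v‖ by positivity)
      linarith
  choose D hD using hD
  have hDcoord := fun k => coord_diagonal_operator (hD k)
  choose A' B' hA'n hB'n hA'B' using fun k => (hdiag k).exists_normalized (he k) hδ h1η hη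
    (D := D k) (fun m j hmj => by rw [hDcoord, if_neg hmj])
    (fun j => by rw [hDcoord, if_pos rfl]; exact hlarge k j)
  set K₁ := (K δ + η) / (1 - η) with hK₁
  have hK₁0 : 0 ≤ K₁ := by positivity
  -- Zero outside `Γ`, so that the image is supported where the functionals are regular.
  obtain ⟨Bt, hBtn, hBt⟩ := exists_operator_of_coordinates (V := EllInfty X Γ) (Y := X)
    (fun k => if h : k ∈ Γ then
      ((B k).comp (B' k)).comp (lp.evalCLM ℝ (fun k : Γ => X k) ∞ ⟨k, h⟩) else 0) hc (fun k => by
      split_ifs with h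
      · refine (ContinuousLinearMap.opNorm_comp_le _ _).trans ?_
        refine (mul_le_of_le_one_right (norm_nonneg _) (norm_evalCLM_le _ _)).trans ?_
        refine (ContinuousLinearMap.opNorm_comp_le _ _).trans ?_
        exact (mul_le_of_le_one_right (norm_nonneg _) (hB'n k)).trans (hBn k)
      · rw [norm_zero]; exact hc)
  obtain ⟨At, hAtn, hAt⟩ := exists_operator_of_coordinates (V := lp X ∞) (Y := fun k : Γ => X k)
    (fun k => ((A' k).comp (A k)).comp (lp.evalCLM ℝ X ∞ (k : ℕ))) (c := K₁ * (c * lam))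
    (by positivity) (fun k => by
      refine (ContinuousLinearMap.opNorm_comp_le _ _).trans ?_
      refine (mul_le_of_le_one_right (norm_nonneg _) (norm_evalCLM_le _ _)).trans ?_
      refine (ContinuousLinearMap.opNorm_comp_le _ _).trans ?_
      exact mul_le_mul (hA'n k) (hAn k) (norm_nonneg _) hK₁0)
  have hest : ∀ z, ‖At (T (Bt z)) - z‖ ≤ η * ‖z‖ := by
    intro z
    let v : ∀ l, X l := fun l => if h : l ∈ Γ then B' l ((z : ∀ k : Γ, X k) ⟨l, h⟩) else 0
    have hvn : ∀ l, ‖v l‖ ≤ ‖z‖ := fun l => by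
      simp only [v]
      split_ifs with h
      · refine ((B' l).le_of_opNorm_le (hB'n l) _).trans ?_
        rw [one_mul]
        exact lp.norm_apply_le_norm ENNReal.top_ne_zero z ⟨l, h⟩
      · rw [norm_zero]; exact norm_nonneg _
    have hBv : ∀ l, (Bt z : ∀ i, X i) l = B l (v l) := fun l => by
      rw [hBt]
      simp only [v]
      split_ifs with h
      · rfl
      · simp
    have hentry : ∀ k j, |f k j ((T (Bt z) : ∀ i, X i) k) - d k j * (e k).coord j (v k)| ≤
        8 * lam * θ * ‖z‖ * (1 / 2) ^ j := by
      intro k j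
      -- Regularity enters here: it expands `T (Bt z)` into the contributions of the single
      -- coordinates `l`, whose errors sum geometrically.
      have h1 : HasSum (fun l => f k j (block T k l (B l (v l))))
          (f k j ((T (Bt z) : ∀ i, X i) k)) := by
        have := hΓ k j (Bt z) fun l hl => by
          rw [hBv]
          simp only [v, dif_neg hl, map_zero]
        simp only [hBv] at this
        exact this
      have h2 := h1.sub (hasSum_ite_eq k (d k j * (e k).coord j (v k)))
      have h3 : HasSum (fun l : ℕ => 4 * lam * θ * ‖z‖ * (1 / 2) ^ j * (1 / 2) ^ l)
          (4 * lam * θ * ‖z‖ * (1 / 2) ^ j * 2) := hasSum_geometric_two.mul_left _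
      have h4 := h2.norm_le_of_bounded h3 fun l => by
        have hpos : 0 ≤ 4 * lam * (θ * (1 / 2) ^ (j + l)) := by positivity
        have hle : 4 * lam * (θ * (1 / 2) ^ (j + l)) * ‖v l‖ ≤
            4 * lam * θ * ‖z‖ * (1 / 2) ^ j * (1 / 2) ^ l := by
          refine (mul_le_mul_of_nonneg_left (hvn l) hpos).trans_eq ?_
          rw [pow_add]; ring
        refine le_trans ?_ hle
        rw [Real.norm_eq_abs]
        split_ifs with hlk
        · subst hlk
          exact hdiagEst l j (v l)
        · rw [sub_zero]
          exact hoffEst k j l hlk (v l)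
      rw [Real.norm_eq_abs] at h4
      linarith
    have hblock : ∀ k, ‖A k ((T (Bt z) : ∀ i, X i) k) - D k (v k)‖ ≤ 16 * lam * θ * ‖z‖ := by
      intro k
      refine le_of_tendsto' ((hA k ((T (Bt z) : ∀ i, X i) k)).sub (hD k (v k))).norm fun n => ?_
      rw [← Finset.sum_sub_distrib]
      simp only [← sub_smul]
      refine (norm_sum_smul_le_of_geometric (he k) (by positivity) (hentry k) _).trans_eq ?_
      ring
    refine lp.norm_le_of_forall_le (by positivity) fun k => ?_
    have hzk : (z : ∀ k : Γ, X k) k = A' k (D k (v k)) := by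
      simp only [v, dif_pos k.2, hA'B']
    have hcomp : (At (T (Bt z)) : ∀ k : Γ, X k) k - (z : ∀ k : Γ, X k) k =
        A' k (A k ((T (Bt z) : ∀ i, X i) k) - D k (v k)) := by
      rw [hAt, map_sub, ← hzk]
      rfl
    rw [lp.coeFn_sub, Pi.sub_apply, hcomp]
    calc _ ≤ K₁ * (16 * lam * θ * ‖z‖) :=
          ((A' k).le_of_opNorm_le (hA'n k) _).trans
            (mul_le_mul_of_nonneg_left (hblock k) hK₁0)
      _ = K₁ * (16 * lam * θ) * ‖z‖ := by ring
      _ ≤ η * ‖z‖ := mul_le_mul_of_nonneg_right hθη (norm_nonneg _)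
  refine idFactorsThrough_of_perturbation T At Bt hη.le hη1 hest ?_
  rw [div_le_iff₀ h1η]
  refine (mul_le_mul hAtn hBtn (norm_nonneg _) (by positivity)).trans_eq ?_
  rw [hK₁]
  field_simp

/-- For each constant above `lam * C * K δ` there are countably many functionals whose regularity
on `Γ` ensures the factorization of the identity on `ℓ^∞(X_k : k ∈ Γ)`. -/
theorem exists_functionals_idFactorsThrough (e : ∀ k, SchauderBasis ℝ (X k))
    (he : ∀ k j, ‖e k j‖ = 1) {C lam : ℝ} (hC : 1 ≤ C) (hlam : 1 ≤ lam) {K : ℝ → ℝ}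
    (hproj : ∀ k n, ‖SchauderBasis.proj (e k) n‖ ≤ lam)
    (hdiag : ∀ k, DiagonalFactorizationProperty (e k) K)
    (hrep : SimultaneouslyStrategicallyReproducible e C) (T : lp X ∞ →L[ℝ] lp X ∞)
    {δ : ℝ} (hδ : 0 < δ) (hKδ : 0 < K δ)
    (hT : ∀ k j, δ ≤ |(e k).coord j (block T k k (e k j))|) {b : ℝ} (hb : lam * C * K δ < b) :
    ∃ φ : ℕ × ℕ → StrongDual ℝ (lp X ∞), ∀ Γ : Set ℕ, (∀ s, RegularOn (φ s) Γ) →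
      IdFactorsThrough (EllInfty X Γ) b T := by
  have hlim : Tendsto (fun η : ℝ => lam * (C + η) * (K δ + η) / (1 - η) ^ 2) (𝓝[>] 0)
      (𝓝 (lam * C * K δ)) := by
    have hcont : ContinuousAt (fun η : ℝ => lam * (C + η) * (K δ + η) / (1 - η) ^ 2) 0 := by
      refine ContinuousAt.div (by fun_prop) (by fun_prop) (by norm_num)
    have := hcont.tendsto.mono_left (nhdsWithin_le_nhds (s := Set.Ioi 0))
    simpa using this
  obtain ⟨η, hηb, hη0, hη1⟩ := ((hlim.eventually (eventually_lt_nhds hb)).and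
    (Ioo_mem_nhdsGT (zero_lt_one' ℝ))).exists
  have h1η : 0 < 1 - η := by linarith
  have hK₁ : 0 < (K δ + η) / (1 - η) := by positivity
  have hlam0 : 0 < lam := by linarith
  -- This `θ` makes the smallness condition `(K δ + η) / (1 - η) * (16 * lam * θ) ≤ η` an equality.
  obtain ⟨x, f, hx, hf, hlarge, hsmall, hbasis⟩ := exists_almost_diagonal_systems e he hC hlam
    hproj hrep T hδ hT hη0 (θ := η / ((K δ + η) / (1 - η) * (16 * lam))) (by positivity)
  refine ⟨fun s => (f s.1 s.2).comp ((lp.evalCLM ℝ X ∞ s.1).comp T), fun Γ hΓ => ?_⟩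
  obtain ⟨A, B, hAB, hid⟩ := idFactorsThrough_of_almost_diagonal e he hlam hproj hdiag T hδ hKδ
    hη0 hη1 (by positivity) (Real.sqrt_nonneg _)
    (by rw [← mul_assoc, mul_div_cancel₀ _ (by positivity)]) x f hx hf hlarge hsmall hbasis Γ
    fun k j => hΓ (k, j)
  rw [Real.sq_sqrt (by linarith)] at hAB
  exact ⟨A, B, hAB.trans hηb.le, hid⟩

end Factorization

end LinftySum

theorem theorem3p4
    {X : ℕ → Type*} [∀ k, NormedAddCommGroup (X k)] [∀ k, NormedSpace ℝ (X k)]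
    [∀ k, CompleteSpace (X k)]
    (e : ∀ k, SchauderBasis ℝ (X k)) (he : ∀ k j, ‖e k j‖ = 1)
    (C lam : ℝ) (hC : 1 ≤ C) (hlam : 1 ≤ lam)
    (K : ℝ → ℝ) (hK : ∀ δ, 0 < δ → 0 < K δ)
    (hbasis : ∀ k, ((e k).nnnormProjBound : ℝ) ≤ lam)
    (hdiag : ∀ k, DiagonalFactorizationProperty (e k) K)
    (hrep : SimultaneouslyStrategicallyReproducible e C)
    (T : lp X ∞ →L[ℝ] lp X ∞)
    (δ : ℝ) (hδ : δ = ⨅ kj : ℕ × ℕ, |diagEntry e T kj.1 kj.2|) (hδ_pos : 0 < δ)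
    (Ω : ℕ → Set ℕ) (hΩ : ∀ l, (Ω l).Infinite) :
    ∃ Γ : Set ℕ, Γ.Infinite ∧ (∀ l, (Γ ∩ Ω l).Infinite) ∧
      IdAlmostFactorsThrough (EllInfty X Γ) (lam * C ^ 2 * K δ) T ∧
      (1 < C → IdFactorsThrough (EllInfty X Γ) (lam * C ^ 2 * K δ) T) := by
  have hT : ∀ k j, δ ≤ |(e k).coord j (block T k k (e k j))| := fun k j => by
    rw [hδ]
    exact ciInf_le ⟨0, by rintro _ ⟨kj, rfl⟩; exact abs_nonneg _⟩ ((k, j) : ℕ × ℕ)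
  have hproj : ∀ k n, ‖SchauderBasis.proj (e k) n‖ ≤ lam := fun k n =>
    (SchauderBasis.norm_proj_le_nnnormProjBound (e k) n).trans (hbasis k)
  have hKδ := hK δ hδ_pos
  have hlam0 : 0 < lam := by linarith
  -- Constants decreasing to `lam * C * K δ` still involve only countably many functionals, so a
  -- single `Γ` serves all of them.
  choose φ hφ using fun n : ℕ => exists_functionals_idFactorsThrough e he hC hlam hproj hdiag hrep
    T hδ_pos hKδ hT (b := lam * C * K δ + 1 / ((n : ℝ) + 1)) (lt_add_of_pos_right _ (by positivity))
  obtain ⟨Γ, hΓΩ, hΓ⟩ := exists_regularOn (fun i : ℕ × ℕ × ℕ => φ i.1 i.2) Ω hΩ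
  have hfac : ∀ b, lam * C * K δ < b → IdFactorsThrough (EllInfty X Γ) b T := by
    intro b hb
    obtain ⟨n, hn⟩ := exists_nat_one_div_lt (sub_pos.2 hb)
    obtain ⟨A, B, hAB, hid⟩ := hφ n Γ fun s => hΓ (n, s)
    exact ⟨A, B, by linarith, hid⟩
  refine ⟨Γ, (hΓΩ 0).mono Set.inter_subset_left, hΓΩ, fun ε hε => hfac _ ?_, fun hC1 => hfac _ ?_⟩
  · have : lam * C * K δ ≤ lam * C ^ 2 * K δ := by
      gcongr
      nlinarith
    linarith
  -- Strict because `C < C ^ 2` when `C > 1`.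
  · gcongr
    nlinarith
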